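/- Let $\mathcal{C}$ be an integral domain, $n\in\mathbb{N}$, $x=(x_1,\dots,x_n)$, and let $\preceq$ be a monomial order on $\mathbb{N}^n$, i.e. a total order compatible with addition (not necessarily a well-ordering) which can be decided algorithmically. For a nonzero polynomial $f$ over a ring, $\exp(f)\in\mathbb{N}^n$ denotes the $\preceq$-maximum of its support. A *standard basis* of a nonzero ideal $I$ of $\mathbf{K}[x]$, $\mathbf{K}$ a field, is a finite set $G\subset I$ with $\{\exp(f): f\in I\smallsetminus\{0\}\}=\bigcup_{g\in G,\,g\neq 0}(\exp(g)+\mathbb{N}^n)$. A *specialization* of $\mathcal{C}$ is a ring homomorphism $\sigma:\mathcal{C}\to\mathbf{K}$ to a field; it is extended to $\mathcal{C}[x]\to\mathbf{K}[x]$ coefficientwise. For $S\subset\mathcal{C}$, $V(S)$ is the set of primes of $\mathcal{C}$ containing $S$. The ring $\mathcal{C}$ is assumed to be effectively presented: its elements are represented by natural numbers through a surjection $\nu:\mathbb{N}\to\mathcal{C}$, the ring operations being computable on representatives. Algorithms are total recursive functions; polynomials are given as finite lists of terms, and finitely generated ideals by finite lists of generators. Suppose that $\mathcal{C}$ is *detachable*: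 there is an algorithm which, given $h,h_1,\dots,h_q\in\mathcal{C}$, decides whether $h\in\sum_j\mathcal{C}h_j$. 1. There is an algorithm which, given finitely generated ideals $J\subset\mathcal{C}[x]$ and $\mathcal{Q}\subset\mathcal{C}$ with $J\nsubseteq\mathcal{C}[x]\mathcal{Q}$, computes a finite set $\mathcal{G}\subset J$ and finitely many $h_i\in\mathcal{C}\smallsetminus\mathcal{Q}$ such that, with $h=\prod_i h_i$, for every field $\mathbf{K}$ and every specialization $\sigma:\mathcal{C}\to\mathbf{K}$ with $\sigma(\mathcal{Q})=\{0\}$ and $\sigma(h)\neq0$: $\sigma(\mathcal{G})$ is a standard basis of the (nonzero) ideal $\mathbf{K}[x]\sigma(J)$, and for each $g\in\mathcal{G}$, $\sigma(g)\ne 0$ and $\exp(\sigma(g))$ is independent of $\sigma$ and $\mathbf{K}$. 2. Suppose moreover that $\mathcal{C}$ is noetherian, and that there is an algorithm which computes generators of the intersection of two finitely generated ideals of $\mathcal{C}$. Then there is an algorithm which, given a finitely generated ideal $J\subset\mathcal{C}[x]$, computes a finite set of triples $(\mathcal{G}_k,\mathcal{Q}_k,h_k)$, with $\mathcal{G}_k\subset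 J$ finite, $\mathcal{Q}_k\subset\mathcal{C}$ an ideal and $h_k\in\mathcal{C}$, and an ideal $\mathcal{I}\subset\mathcal{C}$, such that - $\mathrm{Spec}(\mathcal{C})=\bigcup_k\big(V(\mathcal{Q}_k)\smallsetminus V(h_k)\big)\cup V(\mathcal{I})$; - for every specialization $\sigma$, if $\sigma(\mathcal{I})=\{0\}$ then $\sigma(J)=\{0\}$; - for every $k$, every field $\mathbf{K}$ and every specialization $\sigma:\mathcal{C}\to\mathbf{K}$ with $\sigma(\mathcal{Q}_k)=\{0\}$ and $\sigma(h_k)\neq0$: $\sigma(J)\neq\{0\}$, $\sigma(\mathcal{G}_k)$ is a standard basis of $\mathbf{K}[x]\sigma(J)$, and for each $g\in\mathcal{G}_k$, $\sigma(g)\ne 0$ and $\exp(\sigma(g))$ is independent of $\sigma$ and $\mathbf{K}$. 3. Suppose that $\mathcal{C}$ is noetherian (intersections need not be computable). Then there is an algorithm which computes triples and an ideal $\mathcal{I}$ with the properties in 2 from every finitely generated ideal $J\subset\mathcal{C}[x]$ such that $\sigma(J)\neq\{0\}$ for every specialization $\sigma$ of $\mathcal{C}$. -/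

import Mathlib

universe u v

/-! ## Monomial orders and standard bases -/

/-- A monomial order on `ℕⁿ`: a total order compatible with addition
(not necessarily a well-ordering). -/
structure IsMonomialOrder {n : ℕ} (r : (Fin n →₀ ℕ) → (Fin n →₀ ℕ) → Prop) : Prop where
  refl : ∀ a, r a a
  trans : ∀ a b c, r a b → r b c → r a c
  antisymm : ∀ a b, r a b → r b a → a = b
  total : ∀ a b, r a b ∨ r b a
  add_right : ∀ a b c, r a b → r (a + c) (b + c)

/-- `e` is the leading exponent of the (necessarily nonzero) polynomial `f`:
the maximum of the support of `f` for the order `r`. -/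
def IsLeadingExp {n : ℕ} (r : (Fin n →₀ ℕ) → (Fin n →₀ ℕ) → Prop) {R : Type*} [CommRing R]
    (f : MvPolynomial (Fin n) R) (e : Fin n →₀ ℕ) : Prop :=
  e ∈ f.support ∧ ∀ a ∈ f.support, r a e

/-- The set of leading exponents of the nonzero elements of an ideal. -/
def leadingExps {n : ℕ} (r : (Fin n →₀ ℕ) → (Fin n →₀ ℕ) → Prop) {R : Type*} [CommRing R]
    (I : Ideal (MvPolynomial (Fin n) R)) : Set (Fin n →₀ ℕ) :=
  {e | ∃ f ∈ I, IsLeadingExp r f e}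

/-- `S` is a standard basis of the nonzero ideal `I` of `K[x]`: a finite subset of `I` with
`Exp(I) = ⋃_{g ∈ S} (exp(g) + ℕⁿ)`. -/
structure IsStandardBasis {n : ℕ} (r : (Fin n →₀ ℕ) → (Fin n →₀ ℕ) → Prop)
    {K : Type*} [Field K] (S : Set (MvPolynomial (Fin n) K))
    (I : Ideal (MvPolynomial (Fin n) K)) : Prop where
  ne_bot : I ≠ ⊥
  finite : S.Finite
  subset : ∀ g ∈ S, g ∈ I
  exps : leadingExps r I = {e | ∃ g ∈ S, ∃ a b, IsLeadingExp r g a ∧ e = a + b}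

/-! ## The properties asserted of the outputs -/

/-- For every field `K` and every specialization `σ : C → K` with `σ(Q) = {0}` and `σ(h) ≠ 0`:
`σ(G)` is a standard basis of `K[x]σ(J)`; moreover, for each `g ∈ G`, the leading exponent
of `σ(g)` is defined and independent of `K` and `σ`. -/
def SpecializesToStandardBasis {n : ℕ} (r : (Fin n →₀ ℕ) → (Fin n →₀ ℕ) → Prop)
    {C : Type u} [CommRing C] (J : Ideal (MvPolynomial (Fin n) C))
    (G : Set (MvPolynomial (Fin n) C)) (Q : Ideal C) (h : C) : Prop :=
  (∀ (K : Type v) [Field K] (σ : C →+* K), (∀ a ∈ Q, σ a = 0) → σ h ≠ 0 →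
    IsStandardBasis r (MvPolynomial.map σ '' G) (J.map (MvPolynomial.map σ))) ∧
  (∀ g ∈ G, ∃ e : Fin n →₀ ℕ, ∀ (K : Type v) [Field K] (σ : C →+* K),
    (∀ a ∈ Q, σ a = 0) → σ h ≠ 0 → IsLeadingExp r (MvPolynomial.map σ g) e)

/-- The finite set `G` and the elements `h` in `H` are as wanted for `J` modulo `Q`. -/
structure IsParametricBasis {n : ℕ} (r : (Fin n →₀ ℕ) → (Fin n →₀ ℕ) → Prop)
    {C : Type u} [CommRing C] (J : Ideal (MvPolynomial (Fin n) C)) (Q : Ideal C)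
    (G : Set (MvPolynomial (Fin n) C)) (H : List C) : Prop where
  finite : G.Finite
  subset : ∀ g ∈ G, g ∈ J
  notMem : ∀ h ∈ H, h ∉ Q
  spec : SpecializesToStandardBasis.{u, v} r J G Q H.prod

/-- The triples `(G, Q, h)` in `T` together with the ideal `I` form a stratification for `J`. -/
structure IsStratification {n : ℕ} (r : (Fin n →₀ ℕ) → (Fin n →₀ ℕ) → Prop)
    {C : Type u} [CommRing C] (J : Ideal (MvPolynomial (Fin n) C))
    (T : Set (Set (MvPolynomial (Fin n) C) × Ideal C × C)) (I : Ideal C) : Prop where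
  finite : T.Finite
  finite_basis : ∀ t ∈ T, t.1.Finite
  subset : ∀ t ∈ T, ∀ g ∈ t.1, g ∈ J
  cover : (Set.univ : Set (PrimeSpectrum C)) =
    (⋃ t ∈ T, PrimeSpectrum.zeroLocus (t.2.1 : Set C) \ PrimeSpectrum.zeroLocus {t.2.2}) ∪
      PrimeSpectrum.zeroLocus (I : Set C)
  zero : ∀ (K : Type v) [Field K] (σ : C →+* K), (∀ a ∈ I, σ a = 0) →
    ∀ f ∈ J, MvPolynomial.map σ f = 0
  nonzero : ∀ t ∈ T, ∀ (K : Type v) [Field K] (σ : C →+* K), (∀ a ∈ t.2.1, σ a = 0) →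
    σ t.2.2 ≠ 0 → ∃ f ∈ J, MvPolynomial.map σ f ≠ 0
  spec : ∀ t ∈ T, SpecializesToStandardBasis.{u, v} r J t.1 t.2.1 t.2.2

/-! ## Effectively presented rings

Elements of the ring are handed to algorithms as natural numbers, through a numbering
`ν : ℕ → C`. Algorithms are total recursive functions (Mathlib's `Computable`). -/

/-- `ν` is an effective presentation of `C`: every element has a code (perhaps several), and
the ring operations are computable on codes. -/
structure IsEffectivePresentation {C : Type u} [CommRing C] (ν : ℕ → C) : Prop where
  surjective : Function.Surjective ν
  add : ∃ f : ℕ × ℕ → ℕ, Computable f ∧ ∀ a b, ν (f (a, b)) = ν a + ν b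
  mul : ∃ f : ℕ × ℕ → ℕ, Computable f ∧ ∀ a b, ν (f (a, b)) = ν a * ν b
  neg : ∃ f : ℕ → ℕ, Computable f ∧ ∀ a, ν (f a) = -ν a

/-- The finitely generated ideal of `C` given by a list of codes of generators. -/
def codedIdeal {C : Type u} [CommRing C] (ν : ℕ → C) (q : List ℕ) : Ideal C :=
  Ideal.span {c | ∃ k ∈ q, ν k = c}

/-- `C` is detachable: there is an algorithm which, given `h, h₁, …, h_q`, decides whether `h`
belongs to the ideal generated by `h₁, …, h_q`. -/
def IsDetachable {C : Type u} [CommRing C] (ν : ℕ → C) : Prop :=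
  ComputablePred fun p : ℕ × List ℕ => ν p.1 ∈ codedIdeal ν p.2

/-- There is an algorithm which, given generators of two finitely generated ideals of `C`,
returns generators of their intersection. -/
def HasComputableIntersections {C : Type u} [CommRing C] (ν : ℕ → C) : Prop :=
  ∃ f : List ℕ × List ℕ → List ℕ, Computable f ∧
    ∀ p q, codedIdeal ν (f (p, q)) = codedIdeal ν p ⊓ codedIdeal ν q

/-- There is an algorithm which compares two exponents for the order `r`. -/
def IsDecidableOrder {n : ℕ} (r : (Fin n →₀ ℕ) → (Fin n →₀ ℕ) → Prop) : Prop :=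
  ComputablePred fun p : (Fin n → ℕ) × (Fin n → ℕ) =>
    r (Finsupp.equivFunOnFinite.symm p.1) (Finsupp.equivFunOnFinite.symm p.2)

/-- A code of a polynomial: a list of terms, each given by an exponent and a code of the
coefficient. -/
abbrev PolyCode (n : ℕ) : Type := List ((Fin n → ℕ) × ℕ)

/-- The polynomial with a given code. -/
noncomputable def codedPoly {C : Type u} [CommRing C] (ν : ℕ → C) {n : ℕ} (p : PolyCode n) :
    MvPolynomial (Fin n) C :=
  (p.map fun t => MvPolynomial.monomial (Finsupp.equivFunOnFinite.symm t.1) (ν t.2)).sum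

/-- The finite set of polynomials given by a list of codes. -/
noncomputable def codedPolySet {C : Type u} [CommRing C] (ν : ℕ → C) {n : ℕ} (F : List (PolyCode n)) :
    Set (MvPolynomial (Fin n) C) :=
  {f | ∃ p ∈ F, codedPoly ν p = f}

/-- The finitely generated ideal of `C[x]` given by a list of codes of generators. -/
noncomputable def codedPolyIdeal {C : Type u} [CommRing C] (ν : ℕ → C) {n : ℕ} (F : List (PolyCode n)) :
    Ideal (MvPolynomial (Fin n) C) :=
  Ideal.span (codedPolySet ν F)

/-- A code of a finite set of triples `(G, Q, h)`: each `Q` is given by generators. -/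
abbrev TriplesCode (n : ℕ) : Type := List (List (PolyCode n) × List ℕ × ℕ)

/-- The finite set of triples with a given code. -/
noncomputable def codedTriples {C : Type u} [CommRing C] (ν : ℕ → C) {n : ℕ} (T : TriplesCode n) :
    Set (Set (MvPolynomial (Fin n) C) × Ideal C × C) :=
  {t | ∃ s ∈ T, (codedPolySet ν s.1, codedIdeal ν s.2.1, ν s.2.2) = t}

/-! Every algorithm here is an unbounded search. A total relation whose instances can be confirmed
in finite time contains a computable function (`IsSemidecidable.exists_computable`). It therefore
suffices to give each output a finite certificate which can be confirmed using the ring operations,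
detachability and comparison of exponents, which implies the asserted property, and which exists for
every admissible input.

The certificate (`IsCertificate`) is a finite family in `J`, tagged with leading exponents and
formal degrees, over which the S-polynomials and the generators of `J` reduce modulo `Q` after
multiplication by `h`. These are identities between polynomials over the base ring, so they survive
every specialization that kills `Q` but not `h`; there Buchberger's criterion
(`PairsReduce.exists_of_isLeadingExp`) applies. Since the order need not be a well-order, ordinary
reduction may fail to terminate. Bounding the formal degree, as homogenization would, leaves
finitely many exponents and makes induction possible.

If `Q` is prime, the extension of `J` to the fraction field of the quotient by `Q` has a graded
standard basis by Dickson's lemma (`exists_isGradedBasis`), and clearing denominators turns it into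
a certificate with `h ∉ Q` (`exists_isCertificate`). If `Q` is proper but not prime, two elements
outside `Q` with product in `Q` make the stratum empty, and no polynomial is needed
(`exists_isGenericBasis`). Primality is never tested: the search accepts either kind of evidence.

For the stratification, a prime containing `Q` either avoids the product of the `hᵢ` or contains
some `hᵢ`, hence the strictly larger ideal `Q + (hᵢ)`. Starting from the zero ideal, noetherianity
gives a finite tree (`exists_isTree`) whose leaves are ideals modulo which `J` vanishes. The
coefficients of the generators of `J` lie in every leaf, and the ideal they generate can serve as
`I`. The whole tree is again a finite certificate, found by search. -/

/-! ## Semidecidable predicates -/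

/-- A fold over a list with computable data is computable. -/
theorem Computable.list_foldl {α β σ : Type*} [Primcodable α] [Primcodable β] [Primcodable σ]
    {f : α → List β} {g : α → σ} {h : α → σ × β → σ} (hf : Computable f) (hg : Computable g)
    (hh : Computable₂ h) :
    Computable fun a => (f a).foldl (fun s b => h a (s, b)) (g a) := by
  -- The fold becomes a recursion on an index. Past the end of the list the default `p.2` leaves the
  -- state unchanged, which is why `key` holds for every `n`.
  have hstep : Computable₂ fun (a : α) (p : ℕ × σ) =>
      (((f a)[p.1]?).map fun b => h a (p.2, b)).getD p.2 := by
    refine Computable.option_getD (Computable.option_map ?_ ?_) ?_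
    · exact Computable.list_getElem?.comp (hf.comp .fst) (Computable.fst.comp .snd)
    · exact hh.comp (Computable.fst.comp .fst)
        ((Computable.snd.comp (Computable.snd.comp .fst)).pair .snd)
    · exact Computable.snd.comp .snd
  refine (Computable.nat_rec (Computable.list_length.comp hf) hg hstep).of_eq fun a => ?_
  have key : ∀ n, (Nat.rec (g a) (fun y IH => (((f a)[y]?).map fun b => h a (IH, b)).getD IH) n : σ)
      = ((f a).take n).foldl (fun s b => h a (s, b)) (g a) := by
    intro n
    induction n with
    | zero => simp
    | succ n ih =>
      simp only [ih, List.take_add_one, List.foldl_append]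
      cases (f a)[n]? <;> simp
  simpa using key (f a).length

theorem Computable.list_foldr {α β σ : Type*} [Primcodable α] [Primcodable β] [Primcodable σ]
    {f : α → List β} {g : α → σ} {h : α → β × σ → σ} (hf : Computable f) (hg : Computable g)
    (hh : Computable₂ h) :
    Computable fun a => (f a).foldr (fun b s => h a (b, s)) (g a) :=
  (Computable.list_foldl (Computable.list_reverse.comp hf) hg
    (hh.comp₂ Computable.fst.to₂ ((Computable.snd.pair .fst).comp .snd).to₂)).of_eq fun a => by
      simp [List.foldl_reverse]

theorem Computable.list_map {α β σ : Type*} [Primcodable α] [Primcodable β] [Primcodable σ]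
    {f : α → List β} {g : α → β → σ} (hf : Computable f) (hg : Computable₂ g) :
    Computable fun a => (f a).map (g a) :=
  (Computable.list_foldr hf (.const [])
    (h := fun a p => g a p.1 :: p.2)
    (Computable.list_cons.comp (hg.comp .fst (Computable.fst.comp .snd))
      (Computable.snd.comp .snd))).of_eq fun a => by
    induction f a <;> simp_all

theorem ComputablePred.comp {α β : Type*} [Primcodable α] [Primcodable β] {p : β → Prop}
    (hp : ComputablePred p) {f : α → β} (hf : Computable f) : ComputablePred fun a => p (f a) := by
  obtain ⟨_, h⟩ := hp
  exact ⟨inferInstance, h.comp hf⟩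

theorem computablePred_eq {α β : Type*} [Primcodable α] [Primcodable β] [DecidableEq β]
    {f g : α → β} (hf : Computable f) (hg : Computable g) : ComputablePred fun a => f a = g a :=
  ⟨inferInstance, Primrec.eq.decide.to_comp.comp hf hg⟩

theorem computablePred_le {α : Type*} [Primcodable α] {f g : α → ℕ} (hf : Computable f)
    (hg : Computable g) : ComputablePred fun a => f a ≤ g a :=
  ⟨inferInstance, Primrec.nat_le.decide.to_comp.comp hf hg⟩

/-- A predicate is semidecidable if it is the projection of a computable relation. -/
def IsSemidecidable {α : Type*} [Primcodable α] (p : α → Prop) : Prop :=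
  ∃ f : α → ℕ → Bool, Computable₂ f ∧ ∀ a, p a ↔ ∃ k, f a k = true

namespace IsSemidecidable

variable {α β : Type*} [Primcodable α] [Primcodable β]

theorem of_computablePred {p : α → Prop} (hp : ComputablePred p) : IsSemidecidable p := by
  obtain ⟨_, h⟩ := hp
  exact ⟨fun a _ => decide (p a), (h.comp .fst).to₂, fun a => by simp⟩

theorem comp {p : β → Prop} (hp : IsSemidecidable p) {f : α → β} (hf : Computable f) :
    IsSemidecidable fun a => p (f a) := by
  obtain ⟨g, hg, h⟩ := hp
  exact ⟨fun a k => g (f a) k, hg.comp (hf.comp .fst) .snd, fun a => h _⟩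

theorem of_iff {p q : α → Prop} (hp : IsSemidecidable p) (h : ∀ a, q a ↔ p a) :
    IsSemidecidable q := by
  rwa [show q = p from funext fun a => propext (h a)]

theorem and {p q : α → Prop} (hp : IsSemidecidable p) (hq : IsSemidecidable q) :
    IsSemidecidable fun a => p a ∧ q a := by
  obtain ⟨f, hf, hpf⟩ := hp
  obtain ⟨g, hg, hqg⟩ := hq
  refine ⟨fun a k => f a k.unpair.1 && g a k.unpair.2, ?_, fun a => ?_⟩
  · exact Primrec.and.to_comp.comp
      (hf.comp .fst (Computable.fst.comp (Computable.unpair.comp .snd)))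
      (hg.comp .fst (Computable.snd.comp (Computable.unpair.comp .snd)))
  · simp only [hpf, hqg]
    constructor
    · rintro ⟨⟨i, hi⟩, ⟨j, hj⟩⟩
      exact ⟨Nat.pair i j, by simp [hi, hj]⟩
    · rintro ⟨k, hk⟩
      rw [Bool.and_eq_true] at hk
      exact ⟨⟨_, hk.1⟩, ⟨_, hk.2⟩⟩

theorem or {p q : α → Prop} (hp : IsSemidecidable p) (hq : IsSemidecidable q) :
    IsSemidecidable fun a => p a ∨ q a := by
  obtain ⟨f, hf, hpf⟩ := hp
  obtain ⟨g, hg, hqg⟩ := hq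
  refine ⟨fun a k => f a k || g a k, Primrec.or.to_comp.comp hf hg, fun a => ?_⟩
  simp only [hpf, hqg, Bool.or_eq_true, exists_or]

/-- One number codes both a candidate `b` and a witness for it; numbers that decode to no candidate
are rejected. -/
theorem exists_ {p : α → β → Prop} (hp : IsSemidecidable fun x : α × β => p x.1 x.2) :
    IsSemidecidable fun a => ∃ b, p a b := by
  obtain ⟨f, hf, hpf⟩ := hp
  refine ⟨fun a k => ((Encodable.decode (α := β) k.unpair.1).map
    fun b => f (a, b) k.unpair.2).getD false, ?_, fun a => ?_⟩
  · refine Computable.option_getD (Computable.option_map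
      (Computable.decode.comp (Computable.fst.comp (Computable.unpair.comp .snd))) ?_)
      (.const false)
    exact hf.comp ((Computable.fst.comp .fst).pair .snd)
      (Computable.snd.comp (Computable.unpair.comp (Computable.snd.comp .fst)))
  · constructor
    · rintro ⟨b, hb⟩
      obtain ⟨k, hk⟩ := (hpf (a, b)).1 hb
      exact ⟨Nat.pair (Encodable.encode b) k, by simpa using hk⟩
    · rintro ⟨k, hk⟩
      cases hd : (Encodable.decode (α := β) k.unpair.1) with
      | none => simp [hd] at hk
      | some b => exact ⟨b, (hpf (a, b)).2 ⟨_, by simpa [hd] using hk⟩⟩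

theorem exists_mem {l : α → List β} (hl : Computable l) {p : α → β → Prop}
    (hp : IsSemidecidable fun x : α × β => p x.1 x.2) :
    IsSemidecidable fun a => ∃ b ∈ l a, p a b := by
  classical
  have hmem : IsSemidecidable fun x : α × β => ∃ i, (l x.1)[i]? = some x.2 :=
    .exists_ (.of_computablePred (computablePred_eq
      (Computable.list_getElem?.comp (hl.comp (Computable.fst.comp .fst)) .snd)
      (Computable.option_some.comp (Computable.snd.comp .fst))))
  refine (IsSemidecidable.exists_ (p := fun a b => (∃ i, (l a)[i]? = some b) ∧ p a b)
    (hmem.and hp)).of_iff fun a => ?_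
  simp only [List.mem_iff_getElem?]

/-- The witnesses for the finitely many entries are bundled into one list, and that list is searched
for. -/
theorem forall_mem {l : α → List β} (hl : Computable l) {p : α → β → Prop}
    (hp : IsSemidecidable fun x : α × β => p x.1 x.2) :
    IsSemidecidable fun a => ∀ b ∈ l a, p a b := by
  obtain ⟨f, hf, hpf⟩ := hp
  -- A missing witness is read as `0`, and positions beyond the end of `l a` pass the test.
  let t (a : α) (ks : List ℕ) (i : ℕ) : Bool :=
    (((l a)[i]?).map fun b => f (a, b) ((ks[i]?).getD 0)).getD true
  let F (x : α × List ℕ) : Bool :=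
    Nat.rec true (fun i acc => acc && t x.1 x.2 i) (l x.1).length
  have hF : Computable F := by
    refine Computable.nat_rec (h := fun x p => p.2 && t x.1 x.2 p.1)
      (Computable.list_length.comp (hl.comp .fst)) (.const true) ?_
    refine Primrec.and.to_comp.comp (Computable.snd.comp .snd) ?_
    refine Computable.option_getD (Computable.option_map (Computable.list_getElem?.comp
      (hl.comp (Computable.fst.comp .fst)) (Computable.fst.comp .snd)) ?_) (.const true)
    refine hf.comp ((Computable.fst.comp (Computable.fst.comp .fst)).pair .snd) ?_
    exact Computable.option_getD (Computable.list_getElem?.comp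
      (Computable.snd.comp (Computable.fst.comp .fst))
      (Computable.fst.comp (Computable.snd.comp .fst))) (.const 0)
  have hFt : ∀ a ks, F (a, ks) = true ↔ ∀ i < (l a).length, t a ks i = true := by
    intro a ks
    have : ∀ n, ((Nat.rec true (fun i acc => acc && t a ks i) n : Bool) = true) ↔
        ∀ i < n, t a ks i = true := by
      intro n
      induction n with
      | zero => simp
      | succ n ih => simp only [Bool.and_eq_true, ih, Nat.forall_lt_succ_right]
    exact this _
  have hF' : IsSemidecidable fun a => ∃ ks : List ℕ, F (a, ks) = true :=
    .exists_ (p := fun a ks => F (a, ks) = true) (.of_computablePred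
      ⟨fun x => instDecidableEqBool _ _, by simpa using hF⟩)
  refine hF'.of_iff fun a => ?_
  constructor
  · intro h
    have h' : ∀ b : β, ∃ k, b ∈ l a → f (a, b) k = true := fun b => by
      by_cases hb : b ∈ l a
      · obtain ⟨k, hk⟩ := (hpf (a, b)).1 (h b hb)
        exact ⟨k, fun _ => hk⟩
      · exact ⟨0, fun h => absurd h hb⟩
    choose k hk using h'
    refine ⟨(l a).map k, (hFt _ _).2 fun i hi => ?_⟩
    simp only [t, List.getElem?_map, List.getElem?_eq_getElem hi, Option.map_some,
      Option.getD_some]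
    exact hk _ (List.getElem_mem hi)
  · rintro ⟨ks, hks⟩ b hb
    obtain ⟨i, hi, rfl⟩ := List.mem_iff_getElem.1 hb
    have := (hFt _ _).1 hks i hi
    simp only [t, List.getElem?_eq_getElem hi, Option.map_some, Option.getD_some] at this
    exact (hpf (a, (l a)[i])).2 ⟨_, this⟩

/-- A total semidecidable relation contains a computable function. -/
theorem exists_computable {R : α → β → Prop} (hR : IsSemidecidable fun x : α × β => R x.1 x.2)
    (tot : ∀ a, ∃ b, R a b) : ∃ A : α → β, Computable A ∧ ∀ a, R a (A a) := by
  obtain ⟨f, hf, hRf⟩ := hR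
  -- `k` codes a candidate output together with a witness that it is accepted; totality of `R`
  -- guarantees that the search over `k` stops.
  let g (a : α) (k : ℕ) : Option β := (Encodable.decode (α := β) k.unpair.1).bind fun b =>
    bif f (a, b) k.unpair.2 then some b else none
  have hg : Computable₂ g := by
    refine Computable.option_bind
      (Computable.decode.comp (Computable.fst.comp (Computable.unpair.comp .snd))) ?_
    refine Computable.cond ?_ (Computable.option_some.comp .snd) (.const none)
    exact hf.comp ((Computable.fst.comp .fst).pair .snd)
      (Computable.snd.comp (Computable.unpair.comp (Computable.snd.comp .fst)))
  have hgR : ∀ a k b, b ∈ g a k → R a b := by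
    intro a k b hb
    simp only [g, Option.mem_def, Option.bind_eq_some_iff] at hb
    obtain ⟨c, -, hc⟩ := hb
    cases hfc : f (a, c) k.unpair.2 with
    | false => simp [hfc] at hc
    | true =>
      simp only [hfc, cond_true, Option.some.injEq] at hc
      exact hc ▸ (hRf (a, c)).2 ⟨_, hfc⟩
  have hdom : ∀ a, (Nat.rfindOpt (g a)).Dom := by
    intro a
    obtain ⟨b, hb⟩ := tot a
    obtain ⟨k, hk⟩ := (hRf (a, b)).1 hb
    exact Nat.rfindOpt_dom.2 ⟨Nat.pair (Encodable.encode b) k, b, by simp [g, hk]⟩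
  refine ⟨fun a => (Nat.rfindOpt (g a)).get (hdom a),
    (Partrec.rfindOpt hg).of_eq_tot fun a => Part.get_mem _, fun a => ?_⟩
  obtain ⟨k, hk⟩ := Nat.rfindOpt_spec (Part.get_mem (hdom a))
  exact hgR a k _ hk

end IsSemidecidable

/-! ## Monomial orders -/

namespace IsMonomialOrder

variable {n : ℕ} {r : (Fin n →₀ ℕ) → (Fin n →₀ ℕ) → Prop}

theorem add_left (hr : IsMonomialOrder r) {a b : Fin n →₀ ℕ} (c : Fin n →₀ ℕ) (h : r a b) :
    r (c + a) (c + b) := by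
  rw [add_comm c, add_comm c]
  exact hr.add_right _ _ _ h

theorem exists_max (hr : IsMonomialOrder r) (s : Finset (Fin n →₀ ℕ)) (hs : s.Nonempty) :
    ∃ m ∈ s, ∀ a ∈ s, r a m := by
  classical
  induction hs using Finset.Nonempty.cons_induction with
  | singleton a => exact ⟨a, by simp, by simpa using hr.refl a⟩
  | cons a s ha hs ih =>
    obtain ⟨m, hm, hmax⟩ := ih
    rcases hr.total a m with h | h
    · exact ⟨m, by simp [hm], fun b hb => by
        rcases Finset.mem_cons.1 hb with rfl | hb
        exacts [h, hmax _ hb]⟩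
    · exact ⟨a, by simp, fun b hb => by
        rcases Finset.mem_cons.1 hb with rfl | hb
        exacts [hr.refl _, hr.trans _ _ _ (hmax _ hb) h]⟩

theorem exists_isLeadingExp (hr : IsMonomialOrder r) {R : Type*} [CommRing R]
    {f : MvPolynomial (Fin n) R} (hf : f ≠ 0) : ∃ e, IsLeadingExp r f e :=
  hr.exists_max f.support (by simpa [Finset.nonempty_iff_ne_empty] using hf)

end IsMonomialOrder

namespace MvPolynomial

theorem exists_of_mem_support_monomial_mul {σ R : Type*} [CommRing R] {a γ : σ →₀ ℕ} {c : R}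
    {g : MvPolynomial σ R} (h : γ ∈ (monomial a c * g).support) :
    ∃ δ ∈ g.support, γ = a + δ := by
  rw [mem_support_iff, coeff_monomial_mul'] at h
  split_ifs at h with hle
  · exact ⟨γ - a, mem_support_iff.2 (right_ne_zero_of_mul h), (add_tsub_cancel_of_le hle).symm⟩
  · exact absurd rfl h

/-- The ideal generated by a set is spanned, over the coefficients, by the monomial multiples of
the elements of that set. -/
theorem span_monomial_mul {σ R : Type*} [CommRing R] (T : Set (MvPolynomial σ R)) :
    Submodule.span R {p | ∃ g ∈ T, ∃ a : σ →₀ ℕ, p = monomial a 1 * g} =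
      (Ideal.span T).restrictScalars R := by
  have h := Submodule.span_smul_of_span_eq_top (basisMonomials σ R).span_eq T
  rw [← show Submodule.span (MvPolynomial σ R) T = Ideal.span T from rfl, ← h]
  congr 1
  ext p
  simp only [Set.mem_ofPred_eq, Set.mem_smul, Set.mem_range, coe_basisMonomials, smul_eq_mul]
  constructor
  · rintro ⟨g, hg, a, rfl⟩
    exact ⟨_, ⟨a, rfl⟩, g, hg, rfl⟩
  · rintro ⟨_, ⟨a, rfl⟩, g, hg, rfl⟩
    exact ⟨g, hg, a, rfl⟩

end MvPolynomial

theorem IsLeadingExp.monomial_mul {n : ℕ} {r : (Fin n →₀ ℕ) → (Fin n →₀ ℕ) → Prop}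
    (hr : IsMonomialOrder r) {R : Type*} [CommRing R] {g : MvPolynomial (Fin n) R}
    {e : Fin n →₀ ℕ} (h : IsLeadingExp r g e) (a : Fin n →₀ ℕ) :
    IsLeadingExp r (MvPolynomial.monomial a 1 * g) (a + e) := by
  refine ⟨?_, fun γ hγ => ?_⟩
  · rw [MvPolynomial.mem_support_iff, MvPolynomial.coeff_monomial_mul, one_mul]
    exact MvPolynomial.mem_support_iff.1 h.1
  · obtain ⟨δ, hδ, rfl⟩ := MvPolynomial.exists_of_mem_support_monomial_mul hγ
    exact hr.add_left _ (h.2 _ hδ)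

/-! ## Buchberger's criterion for a graded family

A polynomial is tagged with an exponent (its leading exponent) and with a formal degree. Formal
degrees play the part of a homogenizing variable, so that only finitely many exponents
occur below a given formal degree and orders which are not well-orders are allowed. -/

/-- A polynomial together with an exponent and a formal degree. -/
abbrev TaggedPoly (n : ℕ) (R : Type*) [CommRing R] : Type _ :=
  MvPolynomial (Fin n) R × (Fin n →₀ ℕ) × ℕ

namespace TaggedPoly

open MvPolynomial

variable {n : ℕ} {R : Type*} [CommRing R]

/-- The exponent of `b` is the leading one and is bounded by the formal degree. -/
structure IsTagged (r : (Fin n →₀ ℕ) → (Fin n →₀ ℕ) → Prop) (b : TaggedPoly n R) : Prop where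
  lead : IsLeadingExp r b.1 b.2.1
  degree_le : b.2.1.degree ≤ b.2.2

/-- The monomial multiples of elements of `B` of formal degree at most `d` and with leading
exponent satisfying `P`. -/
def shifts (B : Set (TaggedPoly n R)) (P : (Fin n →₀ ℕ) → Prop) (d : ℕ) :
    Set (MvPolynomial (Fin n) R) :=
  {p | ∃ b ∈ B, ∃ a : Fin n →₀ ℕ, p = monomial a 1 * b.1 ∧ a.degree + b.2.2 ≤ d ∧ P (a + b.2.1)}

/-- The formal degree of the least common multiple of the leading monomials. -/
noncomputable def pairDegree (b b' : TaggedPoly n R) : ℕ :=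
  max ((b'.2.1 - b.2.1).degree + b.2.2) ((b.2.1 - b'.2.1).degree + b'.2.2)

/-- The `S`-polynomial of two tagged polynomials. -/
noncomputable def pair (b b' : TaggedPoly n R) : MvPolynomial (Fin n) R :=
  C (b'.1.coeff b'.2.1) * (monomial (b'.2.1 - b.2.1) 1 * b.1) -
    C (b.1.coeff b.2.1) * (monomial (b.2.1 - b'.2.1) 1 * b'.1)

/-- The exponent of the least common multiple of the leading monomials. -/
noncomputable def pairExp (b b' : TaggedPoly n R) : Fin n →₀ ℕ :=
  (b'.2.1 - b.2.1) + b.2.1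

/-- Leading exponents never exceed formal degrees, so the implication `hP` is needed only in degree
at most `d`. -/
theorem shifts_mono {B : Set (TaggedPoly n R)} {P P' : (Fin n →₀ ℕ) → Prop} {d d' : ℕ}
    (hP : ∀ γ, γ.degree ≤ d → P γ → P' γ) (hB : ∀ b ∈ B, b.2.1.degree ≤ b.2.2) (hd : d ≤ d') :
    shifts B P d ⊆ shifts B P' d' := by
  rintro p ⟨b, hb, a, rfl, had, ha⟩
  refine ⟨b, hb, a, rfl, had.trans hd, hP _ ?_ ha⟩
  have := hB b hb
  rw [map_add]
  omega

theorem monomial_mul_mem_span_shifts {B : Set (TaggedPoly n R)} {P P' : (Fin n →₀ ℕ) → Prop}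
    {d k : ℕ} {δ : Fin n →₀ ℕ} (hP : ∀ γ, P γ → P' (δ + γ)) (hk : δ.degree + d ≤ k)
    {p : MvPolynomial (Fin n) R} (hp : p ∈ Submodule.span R (shifts B P d)) :
    monomial δ 1 * p ∈ Submodule.span R (shifts B P' k) := by
  induction hp using Submodule.span_induction with
  | mem p hp =>
    obtain ⟨b, hb, a, rfl, had, ha⟩ := hp
    refine Submodule.subset_span ⟨b, hb, δ + a, ?_, ?_, ?_⟩
    · rw [← mul_assoc, monomial_mul, one_mul]
    · rw [map_add]; omega
    · rw [add_assoc]; exact hP _ ha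
  | zero => simp
  | add p q _ _ hp hq => rw [mul_add]; exact add_mem hp hq
  | smul c p _ hp => rw [mul_smul_comm]; exact Submodule.smul_mem _ _ hp

theorem exists_shifts_of_mem_ideal {B : Set (TaggedPoly n R)}
    {f : MvPolynomial (Fin n) R} (hf : f ∈ Ideal.span (Prod.fst '' B)) :
    ∃ d, f ∈ Submodule.span R (shifts B (fun _ => True) d) := by
  have hmono : ∀ {d d'}, d ≤ d' → Submodule.span R (shifts B (fun _ => True) d) ≤
      Submodule.span R (shifts B (fun _ => True) d') := fun h =>
    Submodule.span_mono (by
      rintro p ⟨b, hb, a, rfl, had, -⟩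
      exact ⟨b, hb, a, rfl, had.trans h, trivial⟩)
  have hf' : f ∈ (Ideal.span (Prod.fst '' B)).restrictScalars R := hf
  rw [← span_monomial_mul] at hf'
  induction hf' using Submodule.span_induction with
  | mem p hp =>
    obtain ⟨_, ⟨b, hb, rfl⟩, a, rfl⟩ := hp
    exact ⟨_, Submodule.subset_span ⟨b, hb, a, rfl, le_rfl, trivial⟩⟩
  | zero => exact ⟨0, zero_mem _⟩
  | add p q _ _ hp hq =>
    obtain ⟨d, hd⟩ := hp (by rename_i h _; rw [span_monomial_mul] at h; exact h)
    obtain ⟨d', hd'⟩ := hq (by rename_i h; rw [span_monomial_mul] at h; exact h)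
    exact ⟨max d d', add_mem (hmono (le_max_left _ _) hd) (hmono (le_max_right _ _) hd')⟩
  | smul c p h hp =>
    obtain ⟨d, hd⟩ := hp (by rw [span_monomial_mul] at h; exact h)
    exact ⟨d, Submodule.smul_mem _ _ hd⟩

theorem span_shifts_le {B : Set (TaggedPoly n R)} (P : (Fin n →₀ ℕ) → Prop) (d : ℕ) :
    Submodule.span R (shifts B P d) ≤ (Ideal.span (Prod.fst '' B)).restrictScalars R := by
  rw [Submodule.span_le]
  rintro p ⟨b, hb, a, rfl, -, -⟩
  exact Ideal.mul_mem_left _ _ (Ideal.subset_span ⟨b, hb, rfl⟩)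

/-- No monomial of a combination can rise above all the leading exponents allowed by `P`, even when
leading terms cancel. -/
theorem support_of_mem_span_shifts {r : (Fin n →₀ ℕ) → (Fin n →₀ ℕ) → Prop}
    (hr : IsMonomialOrder r) {B : Set (TaggedPoly n R)} (hB : ∀ b ∈ B, b.IsTagged r)
    {P : (Fin n →₀ ℕ) → Prop} {d : ℕ} {f : MvPolynomial (Fin n) R}
    (hf : f ∈ Submodule.span R (shifts B P d)) {γ : Fin n →₀ ℕ} (hγ : γ ∈ f.support) :
    ∃ β, P β ∧ β.degree ≤ d ∧ r γ β := by
  classical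
  induction hf using Submodule.span_induction with
  | mem p hp =>
    obtain ⟨b, hb, a, rfl, had, ha⟩ := hp
    have := (hB b hb).degree_le
    exact ⟨_, ha, by rw [map_add]; omega, ((hB b hb).lead.monomial_mul hr a).2 _ hγ⟩
  | zero => simp at hγ
  | add p q _ _ hp hq =>
    rcases Finset.mem_union.1 (support_add hγ) with h | h
    exacts [hp h, hq h]
  | smul c p _ hp => exact hp (support_smul hγ)

/-- The difference of two multiples with the same leading exponent. -/
theorem sub_mem_span_shifts {r : (Fin n →₀ ℕ) → (Fin n →₀ ℕ) → Prop} (hr : IsMonomialOrder r)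
    {B : Set (TaggedPoly n R)} {b b' : TaggedPoly n R}
    (hS : pair b b' ∈ Submodule.span R (shifts B
      (fun γ => r γ (pairExp b b') ∧ γ ≠ pairExp b b') (pairDegree b b')))
    {α α' β : Fin n →₀ ℕ} {k : ℕ} (hα : α + b.2.1 = β) (hα' : α' + b'.2.1 = β)
    (hk : α.degree + b.2.2 ≤ k) (hk' : α'.degree + b'.2.2 ≤ k) :
    C (b'.1.coeff b'.2.1) * (monomial α 1 * b.1) - C (b.1.coeff b.2.1) * (monomial α' 1 * b'.1) ∈
      Submodule.span R (shifts B (fun γ => r γ β ∧ γ ≠ β) k) := by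
  -- `β` is a common multiple of both leading monomials, so it exceeds their least common multiple
  -- by some `δ`; the difference is `x^δ` times the S-polynomial.
  obtain ⟨δ, h, h'⟩ : ∃ δ, α = δ + (b'.2.1 - b.2.1) ∧ α' = δ + (b.2.1 - b'.2.1) := by
    have hx : ∀ x, α x + b.2.1 x = α' x + b'.2.1 x := fun x => by
      have := DFunLike.congr_fun (hα.trans hα'.symm) x
      simpa using this
    refine ⟨α - (b'.2.1 - b.2.1), ?_, ?_⟩ <;> ext x <;>
      simp only [Finsupp.add_apply, Finsupp.tsub_apply] <;> have := hx x <;> omega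
  have hβ : β = δ + pairExp b b' := by rw [← hα, h, pairExp, add_assoc]
  have hkd : δ.degree + pairDegree b b' ≤ k := by
    rw [h, map_add] at hk
    rw [h', map_add] at hk'
    rw [pairDegree]
    omega
  have := monomial_mul_mem_span_shifts (δ := δ) (P' := fun γ => r γ β ∧ γ ≠ β)
    (fun γ hγ => ⟨by rw [hβ]; exact hr.add_left _ hγ.1, fun h => hγ.2 (by
      rw [hβ] at h; exact add_left_cancel h)⟩) hkd hS
  convert this using 1
  have e1 : (monomial α (1 : R)) = monomial δ 1 * monomial (b'.2.1 - b.2.1) 1 := by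
    rw [monomial_mul, one_mul, h]
  have e2 : (monomial α' (1 : R)) = monomial δ 1 * monomial (b.2.1 - b'.2.1) 1 := by
    rw [monomial_mul, one_mul, h']
  rw [e1, e2, pair]
  ring

/-- `S`-polynomials reduce to zero. -/
def PairsReduce (r : (Fin n →₀ ℕ) → (Fin n →₀ ℕ) → Prop) (B : Set (TaggedPoly n R)) : Prop :=
  ∀ b ∈ B, ∀ b' ∈ B, pair b b' ∈ Submodule.span R (shifts B
    (fun γ => r γ (pairExp b b') ∧ γ ≠ pairExp b b') (pairDegree b b'))

variable {K : Type*} [Field K] {r : (Fin n →₀ ℕ) → (Fin n →₀ ℕ) → Prop}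

/-- Induction on a finite down-set `S` of exponents of degree at most `d`, removing its maximum `β`.
All multiples with leading exponent `β` agree up to scalars and smaller multiples, so one of them
suffices. The reductions of S-polynomials respect formal degree, hence never leave the bound `d`. -/
theorem exists_of_mem_span_shifts (hr : IsMonomialOrder r) {B : Set (TaggedPoly n K)}
    (hB : ∀ b ∈ B, b.IsTagged r) (hS : PairsReduce r B) {d : ℕ} (S : Finset (Fin n →₀ ℕ))
    (hlow : ∀ β ∈ S, ∀ γ, r γ β → γ.degree ≤ d → γ ∈ S) {f : MvPolynomial (Fin n) K}
    (hf : f ∈ Submodule.span K (shifts B (· ∈ S) d)) {e : Fin n →₀ ℕ} (he : IsLeadingExp r f e) :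
    ∃ b ∈ B, ∃ a, e = b.2.1 + a := by
  classical
  induction hc : S.card generalizing S with
  | zero =>
    obtain rfl := Finset.card_eq_zero.1 hc
    obtain ⟨β, hβ, -⟩ := support_of_mem_span_shifts hr hB hf he.1
    simp at hβ
  | succ m ih =>
    obtain ⟨β, hβ, hmax⟩ := hr.exists_max S (Finset.card_pos.1 (by omega))
    have hlow' : ∀ β' ∈ S.erase β, ∀ γ, r γ β' → γ.degree ≤ d → γ ∈ S.erase β := by
      intro β' hβ' γ hγ hd
      obtain ⟨hne, hβS⟩ := Finset.mem_erase.1 hβ'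
      refine Finset.mem_erase.2 ⟨?_, hlow _ hβS _ hγ hd⟩
      rintro rfl
      exact hne (hr.antisymm _ _ (hmax _ hβS) hγ)
    have ih' := fun h => ih (S.erase β) hlow' h (by rw [Finset.card_erase_of_mem hβ, hc]; rfl)
    have hBd : ∀ b ∈ B, b.2.1.degree ≤ b.2.2 := fun b hb => (hB b hb).degree_le
    have hlt : Submodule.span K (shifts B (fun γ => r γ β ∧ γ ≠ β) d) ≤
        Submodule.span K (shifts B (· ∈ S.erase β) d) :=
      Submodule.span_mono (shifts_mono (fun γ hγ h =>
        Finset.mem_erase.2 ⟨h.2, hlow _ hβ _ h.1 hγ⟩) hBd le_rfl)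
    -- If a multiple reaches `β`, then `f` is a scalar times this multiple plus an element of the
    -- smaller span. A nonzero scalar makes `β` the leading exponent of `f`; otherwise `β` can be
    -- dropped.
    by_cases hex : ∃ b ∈ B, ∃ a : Fin n →₀ ℕ, a.degree + b.2.2 ≤ d ∧ a + b.2.1 = β
    · obtain ⟨b, hb, a, had, hab⟩ := hex
      have hle : Submodule.span K (shifts B (· ∈ S) d) ≤
          Submodule.span K {monomial a 1 * b.1} ⊔
            Submodule.span K (shifts B (· ∈ S.erase β) d) := by
        rw [Submodule.span_le]
        rintro p ⟨b', hb', a', rfl, had', ha'⟩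
        by_cases hβ' : a' + b'.2.1 = β
        · have h1 := hlt (sub_mem_span_shifts hr (hS b' hb' b hb) hβ' hab had' had)
          have hc0 : b.1.coeff b.2.1 ≠ 0 := mem_support_iff.1 (hB b hb).lead.1
          have h2 : C (b.1.coeff b.2.1) * (monomial a' 1 * b'.1) ∈
              Submodule.span K {monomial a 1 * b.1} ⊔
                Submodule.span K (shifts B (· ∈ S.erase β) d) := by
            rw [← sub_add_cancel (C (b.1.coeff b.2.1) * (monomial a' 1 * b'.1))
              (C (b'.1.coeff b'.2.1) * (monomial a 1 * b.1))]
            refine add_mem (Submodule.mem_sup_right h1) (Submodule.mem_sup_left ?_)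
            rw [← smul_eq_C_mul]
            exact Submodule.smul_mem _ _ (Submodule.mem_span_singleton_self _)
          rw [← smul_eq_C_mul] at h2
          exact (Submodule.smul_mem_iff _ hc0).1 h2
        · exact Submodule.mem_sup_right (Submodule.subset_span
            ⟨b', hb', a', rfl, had', Finset.mem_erase.2 ⟨hβ', ha'⟩⟩)
      obtain ⟨p, hp, w, hw, rfl⟩ := Submodule.mem_sup.1 (hle hf)
      obtain ⟨c, rfl⟩ := Submodule.mem_span_singleton.1 hp
      have hlead := (hB b hb).lead.monomial_mul hr a
      rw [hab] at hlead
      by_cases hc0 : c = 0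
      · subst hc0
        exact ih' (by simpa using hw)
      · refine ⟨b, hb, a, ?_⟩
        rw [add_comm, hab]
        -- The remainder lies strictly below the maximum `β`, so it cannot cancel the leading term
        -- of the chosen multiple.
        have hw0 : coeff β w = 0 := by
          by_contra h
          obtain ⟨γ, hγ, -, hγ'⟩ := support_of_mem_span_shifts hr hB hw (mem_support_iff.2 h)
          obtain ⟨hne, hγS⟩ := Finset.mem_erase.1 hγ
          exact hne (hr.antisymm _ _ (hmax _ hγS) hγ')
        refine hr.antisymm _ _ ?_ (he.2 _ ?_)
        · obtain ⟨γ, hγ, -, hγ'⟩ := support_of_mem_span_shifts hr hB hf he.1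
          exact hr.trans _ _ _ hγ' (hmax _ hγ)
        · rw [mem_support_iff, coeff_add, hw0, add_zero, coeff_smul]
          exact mul_ne_zero hc0 (mem_support_iff.1 hlead.1)
    · refine ih' (Submodule.span_mono ?_ hf)
      rintro p ⟨b, hb, a, rfl, had, ha⟩
      exact ⟨b, hb, a, rfl, had, Finset.mem_erase.2
        ⟨fun h => hex ⟨b, hb, a, had, h⟩, ha⟩⟩

theorem exists_finset_degree_le (n d : ℕ) :
    ∃ S : Finset (Fin n →₀ ℕ), ∀ γ, γ ∈ S ↔ γ.degree ≤ d :=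
  ⟨(Finsupp.finite_of_degree_le d).toFinset, fun γ => by simp⟩

/-- Buchberger's criterion: if the `S`-polynomials reduce to zero, the leading exponents of the
ideal are the multiples of those of the family. -/
theorem PairsReduce.exists_of_isLeadingExp (hr : IsMonomialOrder r) {B : Set (TaggedPoly n K)}
    (hB : ∀ b ∈ B, b.IsTagged r) (hS : PairsReduce r B) {f : MvPolynomial (Fin n) K}
    (hf : f ∈ Ideal.span (Prod.fst '' B)) {e : Fin n →₀ ℕ} (he : IsLeadingExp r f e) :
    ∃ b ∈ B, ∃ a, e = b.2.1 + a := by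
  obtain ⟨d, hd⟩ := exists_shifts_of_mem_ideal hf
  obtain ⟨S, hmem⟩ := exists_finset_degree_le n d
  refine exists_of_mem_span_shifts hr hB hS S (fun β _ γ _ h => (hmem γ).2 h)
    (Submodule.span_mono (shifts_mono (fun γ hγ _ => (hmem γ).2 hγ)
      (fun b hb => (hB b hb).degree_le) le_rfl) hd) he

/-! ## Existence of a graded standard basis -/

/-- `B` is a graded standard basis of `I`. -/
structure IsGradedBasis (r : (Fin n →₀ ℕ) → (Fin n →₀ ℕ) → Prop)
    (I : Ideal (MvPolynomial (Fin n) K)) (B : Set (TaggedPoly n K)) : Prop where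
  finite : B.Finite
  tagged : ∀ b ∈ B, b.IsTagged r
  mem : ∀ b ∈ B, b.1 ∈ I
  support_le : ∀ b ∈ B, ∀ γ ∈ b.1.support, γ.degree ≤ b.2.2
  exists_dvd : ∀ f ∈ I, ∀ e d, IsLeadingExp r f e → (∀ γ ∈ f.support, γ.degree ≤ d) →
    ∃ b ∈ B, ∃ a, a.degree + b.2.2 ≤ d ∧ a + b.2.1 = e

theorem exists_isGradedBasis (I : Ideal (MvPolynomial (Fin n) K)) :
    ∃ B, IsGradedBasis r I B := by
  -- The first coordinate bounds the excess of the degree of `f` over that of its leading exponent: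
  -- it is the exponent that a homogenizing variable would carry.
  let E : Set (ℕ × (Fin n →₀ ℕ)) := {x | ∃ f ∈ I, IsLeadingExp r f x.2 ∧
    ∀ γ ∈ f.support, γ.degree ≤ x.1 + x.2.degree}
  let T : Set (ℕ × (Fin n →₀ ℕ)) := {x | Minimal (· ∈ E) x}
  -- Dickson's lemma for `ℕ × ℕⁿ`: the minimal elements form an antichain in a well-quasi-order.
  have hT : T.Finite := WellQuasiOrderedLE.finite_of_isAntichain (setOfPred_minimal_antichain _)
  have hTE : ∀ x ∈ T, x ∈ E := fun x hx => hx.prop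
  choose! g hgI hglead hgsupp using hTE
  refine ⟨(fun x => (g x, x.2, x.1 + x.2.degree)) '' T, hT.image _, ?_, ?_, ?_, ?_⟩
  · rintro _ ⟨x, hx, rfl⟩
    exact ⟨hglead x hx, by simp⟩
  · rintro _ ⟨x, hx, rfl⟩
    exact hgI x hx
  · rintro _ ⟨x, hx, rfl⟩
    exact hgsupp x hx
  · intro f hf e d he hd
    have hed := hd e he.1
    obtain ⟨x, hx, hxT⟩ := exists_minimal_le_of_wellFoundedLT (· ∈ E) (d - e.degree, e)
      ⟨f, hf, he, fun γ hγ => by have := hd γ hγ; simp only; omega⟩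
    have h2 : x.2 ≤ e := hx.2
    have h1 : x.1 ≤ d - e.degree := hx.1
    refine ⟨_, ⟨x, hxT, rfl⟩, e - x.2, ?_, tsub_add_cancel_of_le h2⟩
    have : (e - x.2).degree + x.2.degree = e.degree := by
      rw [← map_add, tsub_add_cancel_of_le h2]
    simp only
    omega

/-- Division with degree control: the term at the maximum `β` of `S` is cancelled by a multiple of
formal degree at most `d`, and the rest is treated by induction on `S`. -/
theorem IsGradedBasis.mem_span_shifts (hr : IsMonomialOrder r)
    {I : Ideal (MvPolynomial (Fin n) K)} {B : Set (TaggedPoly n K)} (h : IsGradedBasis r I B)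
    {d : ℕ} (S : Finset (Fin n →₀ ℕ)) (hS : ∀ β ∈ S, β.degree ≤ d)
    (hlow : ∀ β ∈ S, ∀ γ, r γ β → γ.degree ≤ d → γ ∈ S) {f : MvPolynomial (Fin n) K}
    (hf : f ∈ I) (hfS : f.support ⊆ S) : f ∈ Submodule.span K (shifts B (· ∈ S) d) := by
  classical
  induction hc : S.card generalizing S f with
  | zero =>
    obtain rfl := Finset.card_eq_zero.1 hc
    rw [Finset.subset_empty, support_eq_empty] at hfS
    simp [hfS]
  | succ m ih =>
    obtain ⟨β, hβ, hmax⟩ := hr.exists_max S (Finset.card_pos.1 (by omega))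
    have hlow' : ∀ β' ∈ S.erase β, ∀ γ, r γ β' → γ.degree ≤ d → γ ∈ S.erase β := by
      intro β' hβ' γ hγ hd
      obtain ⟨hne, hβS⟩ := Finset.mem_erase.1 hβ'
      refine Finset.mem_erase.2 ⟨?_, hlow _ hβS _ hγ hd⟩
      rintro rfl
      exact hne (hr.antisymm _ _ (hmax _ hβS) hγ)
    have ih' : ∀ f ∈ I, f.support ⊆ S → coeff β f = 0 →
        f ∈ Submodule.span K (shifts B (· ∈ S) d) := fun f hf hfS h0 =>
      Submodule.span_mono (shifts_mono (fun γ _ hγ => Finset.mem_of_mem_erase hγ)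
        (fun b hb => (h.tagged b hb).degree_le) le_rfl) (ih (S.erase β)
        (fun γ hγ => hS γ (Finset.mem_of_mem_erase hγ)) hlow' hf
        (fun γ hγ => Finset.mem_erase.2 ⟨fun h => mem_support_iff.1 hγ (h ▸ h0), hfS hγ⟩)
        (by rw [Finset.card_erase_of_mem hβ, hc]; rfl))
    by_cases h0 : coeff β f = 0
    · exact ih' f hf hfS h0
    · obtain ⟨b, hb, a, had, hab⟩ := h.exists_dvd f hf β d
        ⟨mem_support_iff.2 h0, fun γ hγ => hmax _ (hfS hγ)⟩ (fun γ hγ => hS _ (hfS hγ))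
      have hlead := (h.tagged b hb).lead.monomial_mul hr a
      rw [hab] at hlead
      -- The formal degree bounds the whole support of `b.1`, so subtracting the multiple keeps
      -- every exponent in the finite down-set.
      have hsub : (monomial a 1 * b.1).support ⊆ S := by
        intro γ hγ
        refine hlow β hβ γ (hlead.2 γ hγ) ?_
        obtain ⟨δ, hδ, rfl⟩ := exists_of_mem_support_monomial_mul hγ
        have := h.support_le b hb δ hδ
        rw [map_add]
        omega
      have hgen : monomial a 1 * b.1 ∈ Submodule.span K (shifts B (· ∈ S) d) :=
        Submodule.subset_span ⟨b, hb, a, rfl, had, by rw [hab]; exact hβ⟩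
      have hcoeff := mem_support_iff.1 hlead.1
      set p := monomial a 1 * b.1
      set c := coeff β f / coeff β p
      rw [← sub_add_cancel f (c • p)]
      refine add_mem (ih' _ ?_ ?_ ?_) (Submodule.smul_mem _ _ hgen)
      · rw [smul_eq_C_mul]
        exact sub_mem hf (Ideal.mul_mem_left _ _ (Ideal.mul_mem_left _ _ (h.mem b hb)))
      · exact (support_sub _ _ _).trans (Finset.union_subset hfS (support_smul.trans hsub))
      · rw [coeff_sub, coeff_smul, smul_eq_mul, div_mul_cancel₀ _ hcoeff, sub_self]

theorem IsGradedBasis.mem_ideal (hr : IsMonomialOrder r)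
    {I : Ideal (MvPolynomial (Fin n) K)} {B : Set (TaggedPoly n K)} (h : IsGradedBasis r I B)
    {f : MvPolynomial (Fin n) K} (hf : f ∈ I) : f ∈ Ideal.span (Prod.fst '' B) := by
  obtain ⟨S, hmem⟩ := exists_finset_degree_le n (f.support.sup Finsupp.degree)
  exact span_shifts_le _ _ (h.mem_span_shifts hr S (fun β hβ => (hmem β).1 hβ)
    (fun β _ γ _ hγ => (hmem γ).2 hγ) hf
    (fun γ hγ => (hmem γ).2 (Finset.le_sup (f := Finsupp.degree) hγ)))

theorem pairExp_comm (b b' : TaggedPoly n K) : pairExp b b' = (b.2.1 - b'.2.1) + b'.2.1 := by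
  ext x
  simp only [pairExp, Finsupp.add_apply, Finsupp.tsub_apply]
  omega

/-- An S-polynomial belongs to `I`, has degree at most `pairDegree`, and its terms at `pairExp`
cancel. Division in the down-set of strictly smaller exponents gives the reduction. -/
theorem IsGradedBasis.pairsReduce (hr : IsMonomialOrder r)
    {I : Ideal (MvPolynomial (Fin n) K)} {B : Set (TaggedPoly n K)} (h : IsGradedBasis r I B) :
    PairsReduce r B := by
  classical
  intro b hb b' hb'
  obtain ⟨S, hmem⟩ := exists_finset_degree_le n (pairDegree b b')
  set β := pairExp b b' with hβ
  have hmem' : ∀ γ, γ ∈ S.filter (fun γ => r γ β ∧ γ ≠ β) ↔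
      γ.degree ≤ pairDegree b b' ∧ r γ β ∧ γ ≠ β := fun γ => by
    rw [Finset.mem_filter, hmem]
  have h1 := (h.tagged b hb).lead.monomial_mul hr (b'.2.1 - b.2.1)
  have h2 := (h.tagged b' hb').lead.monomial_mul hr (b.2.1 - b'.2.1)
  rw [← pairExp_comm, ← hβ] at h2
  rw [show b'.2.1 - b.2.1 + b.2.1 = β from rfl] at h1
  refine Submodule.span_mono (shifts_mono (P := (· ∈ S.filter (fun γ => r γ β ∧ γ ≠ β)))
      (fun γ _ hγ => ((hmem' γ).1 hγ).2) (fun b hb => (h.tagged b hb).degree_le) le_rfl)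
    (h.mem_span_shifts hr _ (fun γ hγ => ((hmem' γ).1 hγ).1) ?_ ?_ ?_)
  · intro γ' hγ' γ hγ hd
    obtain ⟨-, h3, h4⟩ := (hmem' γ').1 hγ'
    refine (hmem' γ).2 ⟨hd, hr.trans _ _ _ hγ h3, ?_⟩
    rintro rfl
    exact h4 (hr.antisymm _ _ h3 hγ)
  · exact sub_mem (Ideal.mul_mem_left _ _ (Ideal.mul_mem_left _ _ (h.mem b hb)))
      (Ideal.mul_mem_left _ _ (Ideal.mul_mem_left _ _ (h.mem b' hb')))
  · intro γ hγ
    have hγ' : γ ∈ (monomial (b'.2.1 - b.2.1) 1 * b.1).support ∨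
        γ ∈ (monomial (b.2.1 - b'.2.1) 1 * b'.1).support := by
      rcases Finset.mem_union.1 (support_sub _ _ _ hγ) with h | h <;>
        rw [← smul_eq_C_mul] at h
      exacts [.inl (support_smul h), .inr (support_smul h)]
    refine (hmem' γ).2 ⟨?_, ?_, ?_⟩
    · rcases hγ' with hγ' | hγ' <;>
        obtain ⟨δ, hδ, rfl⟩ := exists_of_mem_support_monomial_mul hγ' <;>
        rw [map_add, pairDegree]
      · have := h.support_le b hb δ hδ
        omega
      · have := h.support_le b' hb' δ hδ
        omega
    · rcases hγ' with hγ' | hγ'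
      exacts [h1.2 γ hγ', h2.2 γ hγ']
    · rintro rfl
      refine mem_support_iff.1 hγ ?_
      have e1 : coeff β (monomial (b'.2.1 - b.2.1) 1 * b.1) = coeff b.2.1 b.1 := by
        rw [show β = b'.2.1 - b.2.1 + b.2.1 from rfl, coeff_monomial_mul, one_mul]
      have e2 : coeff β (monomial (b.2.1 - b'.2.1) 1 * b'.1) = coeff b'.2.1 b'.1 := by
        rw [hβ, pairExp_comm, coeff_monomial_mul, one_mul]
      rw [pair, coeff_sub, coeff_C_mul, coeff_C_mul, e1, e2, mul_comm, sub_self]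

end TaggedPoly

/-! ## Linear combinations modulo an ideal of coefficients, and specializations -/

section Specialization

open MvPolynomial TaggedPoly

variable {n : ℕ} {R : Type*} [CommRing R] {K : Type*} [Field K]

/-- The polynomials which are, modulo `Q`, combinations of elements of `T` with coefficients
in `R`. -/
noncomputable def spanMod (Q : Ideal R) (T : Set (MvPolynomial (Fin n) R)) :
    Submodule R (MvPolynomial (Fin n) R) :=
  Submodule.span R T ⊔ (Q.map C).restrictScalars R

/-- The multiples by monomials of the elements of `G`. -/
def monomialMultiples (G : Set (MvPolynomial (Fin n) R)) : Set (MvPolynomial (Fin n) R) :=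
  {p | ∃ g ∈ G, ∃ a : Fin n →₀ ℕ, p = monomial a 1 * g}

theorem image_monomialMultiples (σ : R →+* K) (G : Set (MvPolynomial (Fin n) R)) :
    map σ '' monomialMultiples G = monomialMultiples (map σ '' G) := by
  ext p
  constructor
  · rintro ⟨_, ⟨g, hg, a, rfl⟩, rfl⟩
    exact ⟨_, ⟨g, hg, rfl⟩, a, by simp⟩
  · rintro ⟨_, ⟨g, hg, rfl⟩, a, rfl⟩
    exact ⟨_, ⟨g, hg, a, rfl⟩, by simp⟩

theorem map_eq_zero_iff_mem_map_C {Q : Ideal R} {σ : R →+* K} (hQ : ∀ a, σ a = 0 ↔ a ∈ Q)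
    {f : MvPolynomial (Fin n) R} : map σ f = 0 ↔ f ∈ Q.map C := by
  simp [mem_map_C_iff, MvPolynomial.ext_iff, coeff_map, hQ]

theorem map_eq_zero_of_mem_map_C {Q : Ideal R} {σ : R →+* K} (hQ : ∀ a ∈ Q, σ a = 0)
    {f : MvPolynomial (Fin n) R} (hf : f ∈ Q.map C) : map σ f = 0 := by
  ext m
  rw [coeff_map, coeff_zero, hQ _ (mem_map_C_iff.1 hf m)]

theorem map_mem_span_of_mem_spanMod {Q : Ideal R} {σ : R →+* K} (hQ : ∀ a ∈ Q, σ a = 0)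
    {T : Set (MvPolynomial (Fin n) R)} {f : MvPolynomial (Fin n) R} (hf : f ∈ spanMod Q T) :
    map σ f ∈ Submodule.span K (map σ '' T) := by
  obtain ⟨p, hp, q, hq, rfl⟩ := Submodule.mem_sup.1 hf
  rw [map_add, map_eq_zero_of_mem_map_C hQ hq, add_zero]
  clear hf
  induction hp using Submodule.span_induction with
  | mem p hp => exact Submodule.subset_span ⟨p, hp, rfl⟩
  | zero => simp
  | add p q _ _ hp hq => rw [map_add]; exact add_mem hp hq
  | smul c p _ hp =>
    rw [smul_eq_C_mul, map_mul, map_C, ← smul_eq_C_mul]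
    exact Submodule.smul_mem _ _ hp

/-- Relations modulo `Q` survive specialization, and the factor `h` becomes an invertible scalar. -/
theorem map_mem_span_of_C_mul_mem_spanMod {Q : Ideal R} {σ : R →+* K} (hQ : ∀ a ∈ Q, σ a = 0)
    {T : Set (MvPolynomial (Fin n) R)} {f : MvPolynomial (Fin n) R} {h : R} (hh : σ h ≠ 0)
    (hf : C h * f ∈ spanMod Q T) : map σ f ∈ Submodule.span K (map σ '' T) := by
  have := map_mem_span_of_mem_spanMod hQ hf
  rw [map_mul, map_C, ← smul_eq_C_mul] at this
  exact (Submodule.smul_mem_iff _ hh).1 this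

/-! ### Residue fields and clearing denominators -/

/-- `σ : R → K` identifies `K` with the fraction field of `R ⧸ Q`. -/
structure IsResidueMap (Q : Ideal R) (σ : R →+* K) : Prop where
  eq_zero_iff : ∀ a, σ a = 0 ↔ a ∈ Q
  exists_div : ∀ l, ∃ a b, σ b ≠ 0 ∧ σ b * l = σ a

theorem exists_isResidueMap {R : Type u} [CommRing R] (Q : Ideal R) [Q.IsPrime] :
    ∃ (L : Type u) (_ : Field L) (σ : R →+* L), IsResidueMap Q σ := by
  refine ⟨FractionRing (R ⧸ Q), inferInstance,
    (algebraMap (R ⧸ Q) (FractionRing (R ⧸ Q))).comp (Ideal.Quotient.mk Q), fun a => ?_,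
    fun l => ?_⟩
  · simp [Ideal.Quotient.eq_zero_iff_mem]
  · obtain ⟨a, b, hb, rfl⟩ := IsFractionRing.div_surjective (A := R ⧸ Q) l
    obtain ⟨a, rfl⟩ := Ideal.Quotient.mk_surjective a
    obtain ⟨b, rfl⟩ := Ideal.Quotient.mk_surjective b
    have hb' := IsFractionRing.to_map_ne_zero_of_mem_nonZeroDivisors (K := FractionRing (R ⧸ Q)) hb
    exact ⟨a, b, hb', mul_div_cancel₀ _ hb'⟩

/-- Each scalar of `K` is a fraction of images from `R`, and a common denominator clears the
finitely many scalars in a combination. -/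
theorem IsResidueMap.exists_lift {Q : Ideal R} {σ : R →+* K} (hσ : IsResidueMap Q σ)
    {T : Set (MvPolynomial (Fin n) R)} {x : MvPolynomial (Fin n) K}
    (hx : x ∈ Submodule.span K (map σ '' T)) :
    ∃ h, σ h ≠ 0 ∧ ∃ p ∈ Submodule.span R T, map σ p = C (σ h) * x := by
  induction hx using Submodule.span_induction with
  | mem x hx =>
    obtain ⟨p, hp, rfl⟩ := hx
    exact ⟨1, by simp, p, Submodule.subset_span hp, by simp⟩
  | zero => exact ⟨1, by simp, 0, zero_mem _, by simp⟩
  | add x y _ _ hx hy =>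
    obtain ⟨h, hh, p, hp, hpx⟩ := hx
    obtain ⟨k, hk, q, hq, hqy⟩ := hy
    refine ⟨h * k, by simp [hh, hk], k • p + h • q,
      add_mem (Submodule.smul_mem _ _ hp) (Submodule.smul_mem _ _ hq), ?_⟩
    simp only [smul_eq_C_mul, map_add, map_mul, map_C, hpx, hqy]
    ring
  | smul l x _ hx =>
    obtain ⟨h, hh, p, hp, hpx⟩ := hx
    obtain ⟨a, b, hb, hab⟩ := hσ.exists_div l
    refine ⟨b * h, by simp [hh, hb], a • p, Submodule.smul_mem _ _ hp, ?_⟩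
    simp only [smul_eq_C_mul, map_mul, map_C, hpx, ← hab]
    ring

/-- A partial converse to specializing relations: after clearing denominators, a relation over the
residue field holds in `R` up to an error with all coefficients in `Q`. -/
theorem IsResidueMap.exists_mem_spanMod {Q : Ideal R} {σ : R →+* K} (hσ : IsResidueMap Q σ)
    {T : Set (MvPolynomial (Fin n) R)} {f : MvPolynomial (Fin n) R}
    (hf : map σ f ∈ Submodule.span K (map σ '' T)) :
    ∃ h, h ∉ Q ∧ C h * f ∈ spanMod Q T := by
  obtain ⟨h, hh, p, hp, hpf⟩ := hσ.exists_lift hf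
  refine ⟨h, fun hQ => hh ((hσ.eq_zero_iff h).2 hQ), ?_⟩
  rw [← add_sub_cancel p (C h * f)]
  refine add_mem (Submodule.mem_sup_left hp) (Submodule.mem_sup_right ?_)
  refine (map_eq_zero_iff_mem_map_C hσ.eq_zero_iff).1 ?_
  rw [map_sub, map_mul, map_C, hpf, sub_self]

theorem IsResidueMap.exists_lift_ideal {Q : Ideal R} {σ : R →+* K} (hσ : IsResidueMap Q σ)
    {J : Ideal (MvPolynomial (Fin n) R)} {x : MvPolynomial (Fin n) K} (hx : x ∈ J.map (map σ)) :
    ∃ h, σ h ≠ 0 ∧ ∃ p ∈ J, map σ p = C (σ h) * x := by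
  have hx' : x ∈ (Ideal.span (map σ '' (J : Set (MvPolynomial (Fin n) R)))).restrictScalars K := hx
  rw [← span_monomial_mul] at hx'
  have hsub : {p | ∃ g ∈ map σ '' (J : Set (MvPolynomial (Fin n) R)), ∃ a : Fin n →₀ ℕ,
      p = monomial a 1 * g} ⊆ map σ '' (J : Set (MvPolynomial (Fin n) R)) := by
    rintro _ ⟨_, ⟨g, hg, rfl⟩, a, rfl⟩
    exact ⟨monomial a 1 * g, J.mul_mem_left _ hg, by simp⟩
  obtain ⟨h, hh, p, hp, hpx⟩ := hσ.exists_lift (Submodule.span_mono hsub hx')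
  exact ⟨h, hh, p, (Submodule.span_le (p := J.restrictScalars R)).2 (fun _ h => h) hp, hpx⟩

/-- Since `Q` is prime, a product of elements outside `Q` stays outside `Q`; this merges finitely
many denominators into one. -/
theorem exists_common_notMem {Q : Ideal R} [hQ : Q.IsPrime] {ι : Type*} {s : Set ι}
    (hs : s.Finite) (P : ι → R → Prop) (hP : ∀ i h k, P i h → P i (k * h))
    (hex : ∀ i ∈ s, ∃ h, h ∉ Q ∧ P i h) : ∃ h, h ∉ Q ∧ ∀ i ∈ s, P i h := by
  induction s, hs using Set.Finite.induction_on with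
  | empty => exact ⟨1, fun h => hQ.ne_top ((Ideal.eq_top_iff_one _).2 h), by simp⟩
  | insert _ _ ih =>
    obtain ⟨h, hh, hPh⟩ := ih fun i hi => hex i (Set.mem_insert_of_mem _ hi)
    obtain ⟨k, hk, hPk⟩ := hex _ (Set.mem_insert _ _)
    refine ⟨k * h, fun hm => (hQ.mem_or_mem hm).elim hk hh, ?_⟩
    rintro i (rfl | hi)
    · rw [mul_comm]
      exact hP _ _ _ hPk
    · exact hP _ _ _ (hPh i hi)

/-! ### Certificates for uniform standard bases -/

/-- The data from which Buchberger's criterion can be verified uniformly in all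
specializations which annihilate `Q` and not `h`. -/
structure IsCertificate (r : (Fin n →₀ ℕ) → (Fin n →₀ ℕ) → Prop)
    (F : Set (MvPolynomial (Fin n) R)) (Q : Ideal R) (B : Set (TaggedPoly n R)) (h : R) :
    Prop where
  nonempty : B.Nonempty
  mem : ∀ b ∈ B, b.1 ∈ Ideal.span F
  lead : ∀ b ∈ B, ∃ w, w * coeff b.2.1 b.1 - h ∈ Q
  below : ∀ b ∈ B, ∀ γ ∈ b.1.support, coeff γ b.1 ∈ Q ∨ r γ b.2.1
  degree_le : ∀ b ∈ B, b.2.1.degree ≤ b.2.2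
  pairs : ∀ b ∈ B, ∀ b' ∈ B, C h * pair b b' ∈ spanMod Q (shifts B
    (fun γ => r γ (pairExp b b') ∧ γ ≠ pairExp b b') (pairDegree b b'))
  gens : ∀ f ∈ F, C h * f ∈ spanMod Q (monomialMultiples (Prod.fst '' B))

/-- Apply a ring homomorphism to the coefficients. -/
noncomputable def TaggedPoly.mapCoeff (σ : R →+* K) (b : TaggedPoly n R) : TaggedPoly n K :=
  (map σ b.1, b.2)

theorem TaggedPoly.map_pair (σ : R →+* K) (b b' : TaggedPoly n R) :
    map σ (pair b b') = pair (mapCoeff σ b) (mapCoeff σ b') := by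
  simp [pair, mapCoeff, coeff_map]

theorem TaggedPoly.image_shifts (σ : R →+* K) (B : Set (TaggedPoly n R))
    (P : (Fin n →₀ ℕ) → Prop) (d : ℕ) :
    map σ '' shifts B P d = shifts (mapCoeff σ '' B) P d := by
  ext p
  constructor
  · rintro ⟨_, ⟨b, hb, a, rfl, had, ha⟩, rfl⟩
    exact ⟨_, ⟨b, hb, rfl⟩, a, by simp [mapCoeff], had, ha⟩
  · rintro ⟨_, ⟨b, hb, rfl⟩, a, rfl, had, ha⟩
    exact ⟨_, ⟨b, hb, a, rfl, had, ha⟩, by simp [mapCoeff]⟩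

theorem TaggedPoly.fst_image_mapCoeff (σ : R →+* K) (B : Set (TaggedPoly n R)) :
    Prod.fst '' (mapCoeff σ '' B) = map σ '' (Prod.fst '' B) := by
  simp only [Set.image_image, mapCoeff]

namespace IsCertificate

variable {r : (Fin n →₀ ℕ) → (Fin n →₀ ℕ) → Prop} {F : Set (MvPolynomial (Fin n) R)}
  {Q : Ideal R} {B : Set (TaggedPoly n R)} {h : R}

/-- Modulo `Q`, `h` is a multiple of each leading coefficient, so that coefficient cannot vanish
unless `σ h` does. Coefficients at exponents not below the tag lie in `Q` and disappear. -/
theorem isTagged (H : IsCertificate r F Q B h) {σ : R →+* K} (hQ : ∀ a ∈ Q, σ a = 0)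
    (hh : σ h ≠ 0) {b : TaggedPoly n R} (hb : b ∈ B) : (mapCoeff σ b).IsTagged r := by
  refine ⟨⟨?_, fun γ hγ => ?_⟩, H.degree_le b hb⟩
  · rw [mem_support_iff]
    simp only [mapCoeff, coeff_map]
    intro h0
    obtain ⟨w, hw⟩ := H.lead b hb
    have := hQ _ hw
    rw [map_sub, map_mul, h0, mul_zero, zero_sub, neg_eq_zero] at this
    exact hh this
  · simp only [mapCoeff, mem_support_iff, coeff_map] at hγ
    have hγ' : γ ∈ b.1.support := mem_support_iff.2 fun h0 => hγ (by rw [h0, map_zero])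
    exact (H.below b hb γ hγ').resolve_left fun h0 => hγ (hQ _ h0)

theorem isStandardBasis (hr : IsMonomialOrder r) (H : IsCertificate r F Q B h) (hB : B.Finite)
    {σ : R →+* K} (hQ : ∀ a ∈ Q, σ a = 0) (hh : σ h ≠ 0) :
    IsStandardBasis r (map σ '' (Prod.fst '' B)) ((Ideal.span F).map (map σ)) := by
  have htag : ∀ b ∈ mapCoeff σ '' B, b.IsTagged r := by
    rintro _ ⟨b, hb, rfl⟩
    exact H.isTagged hQ hh hb
  have hpairs : PairsReduce r (mapCoeff σ '' B) := by
    rintro _ ⟨b, hb, rfl⟩ _ ⟨b', hb', rfl⟩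
    rw [← map_pair, ← image_shifts]
    exact map_mem_span_of_C_mul_mem_spanMod hQ hh (H.pairs b hb b' hb')
  have hsub : ∀ g ∈ map σ '' (Prod.fst '' B), g ∈ (Ideal.span F).map (map σ) := by
    rintro _ ⟨_, ⟨b, hb, rfl⟩, rfl⟩
    exact Ideal.mem_map_of_mem _ (H.mem b hb)
  have hle : (Ideal.span F).map (map σ) ≤ Ideal.span (Prod.fst '' (mapCoeff σ '' B)) := by
    rw [Ideal.map_span, Ideal.span_le, fst_image_mapCoeff]
    rintro _ ⟨f, hf, rfl⟩
    have := map_mem_span_of_C_mul_mem_spanMod hQ hh (H.gens f hf)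
    rw [image_monomialMultiples, monomialMultiples, span_monomial_mul] at this
    exact this
  refine ⟨?_, (hB.image _).image _, hsub, ?_⟩
  · obtain ⟨b, hb⟩ := H.nonempty
    have h1 := (H.isTagged hQ hh hb).lead.1
    intro hbot
    have h2 := hsub _ ⟨_, ⟨b, hb, rfl⟩, rfl⟩
    rw [hbot, Ideal.mem_bot] at h2
    simp [mapCoeff, h2] at h1
  · ext e
    constructor
    · rintro ⟨f, hf, he⟩
      obtain ⟨b, hb, a, rfl⟩ := hpairs.exists_of_isLeadingExp hr htag (hle hf) he
      obtain ⟨b₀, hb₀, rfl⟩ := hb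
      exact ⟨_, ⟨_, ⟨b₀, hb₀, rfl⟩, rfl⟩, _, a, (H.isTagged hQ hh hb₀).lead, rfl⟩
    · rintro ⟨g, hg, a, b, hga, rfl⟩
      exact ⟨monomial b 1 * g, Ideal.mul_mem_left _ _ (hsub g hg), by
        rw [add_comm]
        exact hga.monomial_mul hr b⟩

theorem specializesToStandardBasis {R : Type u} [CommRing R]
    {F : Set (MvPolynomial (Fin n) R)} {Q : Ideal R} {B : Set (TaggedPoly n R)} {h : R}
    (hr : IsMonomialOrder r) (H : IsCertificate r F Q B h) (hB : B.Finite) :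
    SpecializesToStandardBasis.{u, v} r (Ideal.span F) (Prod.fst '' B) Q h := by
  refine ⟨fun K _ σ hQ hh => H.isStandardBasis hr hB hQ hh, ?_⟩
  rintro _ ⟨b, hb, rfl⟩
  exact ⟨b.2.1, fun K _ σ hQ hh => (H.isTagged hQ hh hb).lead⟩

end IsCertificate

/-- Lifting a basis through a residue map is possible only up to nonzero scalars; these change
neither supports nor leading exponents. -/
theorem TaggedPoly.IsGradedBasis.rescale {r : (Fin n →₀ ℕ) → (Fin n →₀ ℕ) → Prop}
    {I : Ideal (MvPolynomial (Fin n) K)} {B : Set (TaggedPoly n K)} (H : IsGradedBasis r I B)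
    {φ : TaggedPoly n K → TaggedPoly n K}
    (hφ : ∀ b ∈ B, (φ b).2 = b.2 ∧ ∃ c : K, c ≠ 0 ∧ (φ b).1 = C c * b.1) :
    IsGradedBasis r I (φ '' B) := by
  have hsupp : ∀ b ∈ B, (φ b).1.support = b.1.support := by
    intro b hb
    obtain ⟨-, c, hc, h⟩ := hφ b hb
    ext γ
    simp [h, hc]
  refine ⟨H.finite.image _, ?_, ?_, ?_, ?_⟩
  · rintro _ ⟨b, hb, rfl⟩
    refine ⟨?_, ?_⟩
    · rw [IsLeadingExp, hsupp b hb, (hφ b hb).1]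
      exact (H.tagged b hb).lead
    · rw [(hφ b hb).1]
      exact (H.tagged b hb).degree_le
  · rintro _ ⟨b, hb, rfl⟩
    obtain ⟨-, c, -, h⟩ := hφ b hb
    rw [h]
    exact Ideal.mul_mem_left _ _ (H.mem b hb)
  · rintro _ ⟨b, hb, rfl⟩
    rw [hsupp b hb, (hφ b hb).1]
    exact H.support_le b hb
  · intro f hf e d he hd
    obtain ⟨b, hb, a, h⟩ := H.exists_dvd f hf e d he hd
    exact ⟨_, ⟨b, hb, rfl⟩, a, by rwa [(hφ b hb).1]⟩

theorem C_mul_mem_spanMod {Q : Ideal R} {T : Set (MvPolynomial (Fin n) R)}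
    {f : MvPolynomial (Fin n) R} (h k : R) (hf : C h * f ∈ spanMod Q T) :
    C (k * h) * f ∈ spanMod Q T := by
  rw [C_mul, mul_assoc, ← smul_eq_C_mul]
  exact Submodule.smul_mem _ _ hf

theorem IsResidueMap.exists_pairs {r : (Fin n →₀ ℕ) → (Fin n →₀ ℕ) → Prop}
    (hr : IsMonomialOrder r) {Q : Ideal R} [Q.IsPrime] {σ : R →+* K} (hσ : IsResidueMap Q σ)
    {B : Set (TaggedPoly n R)} (hB : B.Finite) {I : Ideal (MvPolynomial (Fin n) K)}
    (hgr : IsGradedBasis r I (mapCoeff σ '' B)) :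
    ∃ h, h ∉ Q ∧ ∀ b ∈ B, ∀ b' ∈ B, C h * pair b b' ∈ spanMod Q (shifts B
      (fun γ => r γ (pairExp b b') ∧ γ ≠ pairExp b b') (pairDegree b b')) := by
  refine exists_common_notMem (Q := Q) hB (fun b h => ∀ b' ∈ B, C h * pair b b' ∈ spanMod Q
    (shifts B (fun γ => r γ (pairExp b b') ∧ γ ≠ pairExp b b') (pairDegree b b')))
    (fun b h k hb b' hb' => C_mul_mem_spanMod h k (hb b' hb')) fun b hb => ?_
  refine exists_common_notMem (Q := Q) hB (fun b' h => C h * pair b b' ∈ spanMod Q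
    (shifts B (fun γ => r γ (pairExp b b') ∧ γ ≠ pairExp b b') (pairDegree b b')))
    (fun b' h k hb' => C_mul_mem_spanMod h k hb') fun b' hb' => ?_
  refine hσ.exists_mem_spanMod ?_
  rw [map_pair, image_shifts]
  exact hgr.pairsReduce hr (mapCoeff σ b) ⟨b, hb, rfl⟩ (mapCoeff σ b') ⟨b', hb', rfl⟩

/-- Certificates exist modulo a prime ideal. -/
theorem exists_isCertificate {r : (Fin n →₀ ℕ) → (Fin n →₀ ℕ) → Prop} (hr : IsMonomialOrder r)
    {R : Type u} [CommRing R] {F : Set (MvPolynomial (Fin n) R)} (hF : F.Finite) {Q : Ideal R}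
    [hQ : Q.IsPrime] (hFQ : ∃ f ∈ F, f ∉ Q.map C) :
    ∃ B : Set (TaggedPoly n R), B.Finite ∧ ∃ h, h ∉ Q ∧ IsCertificate r F Q B h := by
  obtain ⟨L, _, σ, hσ⟩ := exists_isResidueMap Q
  set I := (Ideal.span F).map (map σ) with hI
  obtain ⟨B₀, hB₀⟩ := exists_isGradedBasis (r := r) I
  have hlift : ∀ b : TaggedPoly n L, ∃ p : MvPolynomial (Fin n) R, b ∈ B₀ →
      p ∈ Ideal.span F ∧ ∃ h, σ h ≠ 0 ∧ map σ p = C (σ h) * b.1 := by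
    intro b
    by_cases hb : b ∈ B₀
    · obtain ⟨h, hh, p, hp, hpb⟩ := hσ.exists_lift_ideal (hB₀.mem b hb)
      exact ⟨p, fun _ => ⟨hp, h, hh, hpb⟩⟩
    · exact ⟨0, fun h => absurd h hb⟩
  choose ℓ hℓ using hlift
  set B : Set (TaggedPoly n R) := (fun b => (ℓ b, b.2)) '' B₀ with hBdef
  have hB : B.Finite := hB₀.finite.image _
  have hgr : IsGradedBasis r I (mapCoeff σ '' B) := by
    rw [hBdef, Set.image_image]
    refine hB₀.rescale fun b hb => ⟨rfl, ?_⟩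
    obtain ⟨-, h, hh, hhb⟩ := hℓ b hb
    exact ⟨σ h, hh, hhb⟩
  have htag : ∀ b ∈ B, (mapCoeff σ b).IsTagged r := fun b hb => hgr.tagged _ ⟨b, hb, rfl⟩
  -- `h₁`, `h₂` and `h₃` serve the leading coefficients, the S-polynomials and the generators
  -- respectively; each condition is stable under multiples of `h`, so the product satisfies all
  -- three.
  obtain ⟨h₁, hh₁, H₁⟩ := exists_common_notMem (Q := Q) hB
    (fun b h => ∃ w, w * coeff b.2.1 b.1 - h ∈ Q)
    (by
      rintro b h k ⟨w, hw⟩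
      exact ⟨k * w, by rw [mul_assoc, ← mul_sub]; exact Q.mul_mem_left _ hw⟩)
    (by
      intro b hb
      refine ⟨coeff b.2.1 b.1, fun hm => ?_, 1, by simp⟩
      have := mem_support_iff.1 (htag b hb).lead.1
      simp only [mapCoeff, coeff_map] at this
      exact this ((hσ.eq_zero_iff _).2 hm))
  obtain ⟨h₂, hh₂, H₂⟩ := hσ.exists_pairs hr hB hgr
  obtain ⟨h₃, hh₃, H₃⟩ := exists_common_notMem (Q := Q) hF
    (fun f h => C h * f ∈ spanMod Q (monomialMultiples (Prod.fst '' B)))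
    (fun x h k => C_mul_mem_spanMod h k)
    (by
      intro f hf
      refine hσ.exists_mem_spanMod ?_
      rw [image_monomialMultiples, monomialMultiples, span_monomial_mul, ← fst_image_mapCoeff]
      exact hgr.mem_ideal hr (Ideal.mem_map_of_mem _ (Ideal.subset_span hf)))
  refine ⟨B, hB, h₁ * h₂ * h₃,
    fun hm => (hQ.mem_or_mem hm).elim (fun hm => (hQ.mem_or_mem hm).elim hh₁ hh₂) hh₃, ?_⟩
  constructor
  -- A generator that survives modulo `Q` has a leading exponent over the residue field, and some
  -- basis element must divide it.
  · obtain ⟨f, hf, hfQ⟩ := hFQ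
    have hf0 : map σ f ≠ 0 := fun h0 => hfQ ((map_eq_zero_iff_mem_map_C hσ.eq_zero_iff).1 h0)
    obtain ⟨e, he⟩ := hr.exists_isLeadingExp hf0
    obtain ⟨_, ⟨b, hb, rfl⟩, -⟩ := hgr.exists_dvd _
      (Ideal.mem_map_of_mem _ (Ideal.subset_span hf)) e _ he
      fun γ hγ => Finset.le_sup (f := Finsupp.degree) hγ
    exact ⟨b, hb⟩
  · rintro _ ⟨b, hb, rfl⟩
    exact (hℓ b hb).1
  · intro b hb
    obtain ⟨w, hw⟩ := H₁ b hb
    refine ⟨h₂ * h₃ * w, ?_⟩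
    rw [show h₂ * h₃ * w * coeff b.2.1 b.1 - h₁ * h₂ * h₃ =
      (h₂ * h₃) * (w * coeff b.2.1 b.1 - h₁) by ring]
    exact Q.mul_mem_left _ hw
  · intro b hb γ hγ
    by_cases hm : coeff γ b.1 ∈ Q
    · exact .inl hm
    · refine .inr ((htag b hb).lead.2 γ (mem_support_iff.2 ?_))
      simpa only [mapCoeff, coeff_map, ne_eq, hσ.eq_zero_iff] using hm
  · exact fun b hb => (htag b hb).degree_le
  · intro b hb b' hb'
    rw [show h₁ * h₂ * h₃ = (h₁ * h₃) * h₂ by ring]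
    exact C_mul_mem_spanMod _ _ (H₂ b hb b' hb')
  · exact fun f hf => C_mul_mem_spanMod _ _ (H₃ f hf)

end Specialization

/-! ## Computations with codes -/

section Codes

open MvPolynomial

variable {n : ℕ}

theorem Computable.exponent_add {α : Type*} [Primcodable α] {a b : α → Fin n → ℕ}
    (ha : Computable a) (hb : Computable b) : Computable fun x => a x + b x := by
  have h : Primrec₂ fun a b : Fin n → ℕ => a + b := Primrec.fin_curry.2
    (Primrec.nat_add.comp (Primrec.fin_app.comp (Primrec.fst.comp .fst) .snd)
      (Primrec.fin_app.comp (Primrec.snd.comp .fst) .snd))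
  exact h.to_comp.comp ha hb

theorem Computable.exponent_sub {α : Type*} [Primcodable α] {a b : α → Fin n → ℕ}
    (ha : Computable a) (hb : Computable b) : Computable fun x => a x - b x := by
  have h : Primrec₂ fun a b : Fin n → ℕ => a - b := Primrec.fin_curry.2
    (Primrec.nat_sub.comp (Primrec.fin_app.comp (Primrec.fst.comp .fst) .snd)
      (Primrec.fin_app.comp (Primrec.snd.comp .fst) .snd))
  exact h.to_comp.comp ha hb

/-- The exponent with a given code. -/
noncomputable abbrev codedExp (e : Fin n → ℕ) : Fin n →₀ ℕ := Finsupp.equivFunOnFinite.symm e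

theorem codedExp_add (a b : Fin n → ℕ) : codedExp (a + b) = codedExp a + codedExp b := by
  ext; simp

theorem codedExp_sub (a b : Fin n → ℕ) : codedExp (a - b) = codedExp a - codedExp b := by
  ext; simp

theorem exists_codedExp_eq (e : Fin n →₀ ℕ) : ∃ a, codedExp a = e :=
  Finsupp.equivFunOnFinite.symm.surjective e

theorem codedExp_injective : Function.Injective (codedExp (n := n)) :=
  Finsupp.equivFunOnFinite.symm.injective

theorem Computable.degree_codedExp {α : Type*} [Primcodable α] {a : α → Fin n → ℕ}
    (ha : Computable a) : Computable fun x => (codedExp (a x)).degree := by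
  have hadd : Primrec₂ fun (_ : Fin n → ℕ) (p : ℕ × ℕ) => p.1 + p.2 :=
    Primrec.nat_add.comp (Primrec.fst.comp .snd) (Primrec.snd.comp .snd)
  have h : Primrec fun a : Fin n → ℕ => (List.ofFn a).foldr (fun x s => x + s) 0 :=
    Primrec.list_foldr (Primrec.list_ofFn fun i => Primrec.fin_app.comp .id (.const i))
      (.const 0) hadd
  refine (h.to_comp.comp ha).of_eq fun x => ?_
  rw [Finsupp.degree_eq_sum]
  change (List.ofFn (a x)).sum = _
  rw [List.sum_ofFn]
  rfl

/-- Multiplication by a monomial, on codes. -/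
def monomialMulCode (a : Fin n → ℕ) (p : PolyCode n) : PolyCode n := p.map fun t => (a + t.1, t.2)

theorem Computable.monomialMulCode {α : Type*} [Primcodable α] {a : α → Fin n → ℕ}
    {p : α → PolyCode n} (ha : Computable a) (hp : Computable p) :
    Computable fun x => monomialMulCode (a x) (p x) :=
  Computable.list_map hp ((Computable.exponent_add (ha.comp .fst)
    (Computable.fst.comp .snd)).pair (Computable.snd.comp .snd))

variable {R : Type u} [CommRing R] (ν : ℕ → R)

theorem codedPoly_nil : codedPoly ν ([] : PolyCode n) = 0 := rfl

theorem codedPoly_cons (t : (Fin n → ℕ) × ℕ) (p : PolyCode n) :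
    codedPoly ν (t :: p) = monomial (codedExp t.1) (ν t.2) + codedPoly ν p := by
  simp [codedPoly]

theorem codedPoly_append (p q : PolyCode n) :
    codedPoly ν (p ++ q) = codedPoly ν p + codedPoly ν q := by
  simp [codedPoly]

theorem codedPoly_monomialMulCode (a : Fin n → ℕ) (p : PolyCode n) :
    codedPoly ν (monomialMulCode a p) = monomial (codedExp a) 1 * codedPoly ν p := by
  induction p with
  | nil => simp [monomialMulCode, codedPoly_nil]
  | cons t p ih =>
    rw [monomialMulCode, List.map_cons, ← monomialMulCode, codedPoly_cons, codedPoly_cons, ih,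
      mul_add, monomial_mul, one_mul, codedExp_add]

theorem exists_mem_of_mem_support_codedPoly {p : PolyCode n} {γ : Fin n →₀ ℕ}
    (h : γ ∈ (codedPoly ν p).support) : ∃ t ∈ p, codedExp t.1 = γ := by
  classical
  induction p with
  | nil => simp [codedPoly_nil] at h
  | cons t p ih =>
    rw [codedPoly_cons] at h
    rcases Finset.mem_union.1 (support_add h) with h | h
    · exact ⟨t, by simp, (Finset.mem_singleton.1 (support_monomial_subset h)).symm⟩
    · obtain ⟨s, hs, h⟩ := ih h
      exact ⟨s, by simp [hs], h⟩

theorem codedPoly_surjective {ν : ℕ → R} (hν : Function.Surjective ν) :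
    Function.Surjective (codedPoly ν (n := n)) := by
  intro f
  induction f using MvPolynomial.induction_on' with
  | monomial a b =>
    obtain ⟨k, rfl⟩ := hν b
    obtain ⟨e, rfl⟩ := exists_codedExp_eq a
    exact ⟨[(e, k)], by rw [codedPoly_cons, codedPoly_nil, add_zero]⟩
  | add f g hf hg =>
    obtain ⟨p, rfl⟩ := hf
    obtain ⟨q, rfl⟩ := hg
    exact ⟨p ++ q, codedPoly_append _ _ _⟩

/-- A code may repeat an exponent, so the coefficient is the sum over all matching terms. -/
theorem IsEffectivePresentation.exists_coeff {ν : ℕ → R} (hν : IsEffectivePresentation ν) :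
    ∃ f : PolyCode n × (Fin n → ℕ) → ℕ, Computable f ∧
      ∀ p e, ν (f (p, e)) = coeff (codedExp e) (codedPoly ν p) := by
  classical
  obtain ⟨add, hadd, add_spec⟩ := hν.add
  -- Any code of zero will do: it enters the algorithm as a constant.
  obtain ⟨z, hz⟩ := hν.surjective 0
  have hstep : Computable₂ fun (x : PolyCode n × (Fin n → ℕ)) (p : ((Fin n → ℕ) × ℕ) × ℕ) =>
      bif decide (p.1.1 = x.2) then add (p.1.2, p.2) else p.2 := by
    have ht : Computable₂ fun (_ : PolyCode n × (Fin n → ℕ)) (p : ((Fin n → ℕ) × ℕ) × ℕ) => p.1 :=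
      Computable.fst.comp .snd
    refine .cond ?_ ?_ ?_
    · exact Primrec.eq.decide.to_comp.comp (Computable.fst.comp ht) (Computable.snd.comp .fst)
    · exact hadd.comp ((Computable.snd.comp ht).pair (Computable.snd.comp .snd))
    · exact Computable.snd.comp .snd
  refine ⟨_, Computable.list_foldr .fst (.const z) hstep, fun p e => ?_⟩
  induction p with
  | nil => simpa [codedPoly_nil] using hz
  | cons t p ih =>
    simp only [List.foldr_cons, codedPoly_cons, coeff_add, coeff_monomial] at ih ⊢
    by_cases h : t.1 = e
    · simp [h, add_spec, ih]
    · simp [h, ih]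

theorem IsEffectivePresentation.exists_linearCombination {ν : ℕ → R}
    (hν : IsEffectivePresentation ν) :
    ∃ f : List (ℕ × PolyCode n) → PolyCode n, Computable f ∧
      ∀ l, codedPoly ν (f l) = (l.map fun t => C (ν t.1) * codedPoly ν t.2).sum := by
  obtain ⟨mul, hmul, mul_spec⟩ := hν.mul
  have hstep : Computable₂ fun (_ : List (ℕ × PolyCode n)) (p : (ℕ × PolyCode n) × PolyCode n) =>
      (p.1.2.map fun m => (m.1, mul (p.1.1, m.2))) ++ p.2 := by
    refine Computable.list_append.comp (Computable.list_map (f := fun x :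
      List (ℕ × PolyCode n) × ((ℕ × PolyCode n) × PolyCode n) => x.2.1.2)
      (g := fun x m => (m.1, mul (x.2.1.1, m.2))) ?_ ?_) ?_
    · exact Computable.snd.comp (Computable.fst.comp .snd)
    · exact (Computable.fst.comp .snd).pair (hmul.comp
        ((Computable.fst.comp (Computable.fst.comp (Computable.snd.comp .fst))).pair
          (Computable.snd.comp .snd)))
    · exact Computable.snd.comp .snd
  refine ⟨_, Computable.list_foldr .id (.const []) hstep, fun l => ?_⟩
  have key : ∀ (c : ℕ) (p : PolyCode n),
      codedPoly ν (p.map fun m => (m.1, mul (c, m.2))) = C (ν c) * codedPoly ν p := by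
    intro c p
    induction p with
    | nil => simp [codedPoly_nil]
    | cons t p ih =>
      rw [List.map_cons, codedPoly_cons, codedPoly_cons, ih, mul_add, C_mul_monomial, mul_spec]
  induction l with
  | nil => simp [codedPoly_nil]
  | cons t l ih => simp_all [codedPoly_append]

theorem IsEffectivePresentation.exists_prod {ν : ℕ → R} (hν : IsEffectivePresentation ν) :
    ∃ f : List ℕ → ℕ, Computable f ∧ ∀ l, ν (f l) = (l.map ν).prod := by
  obtain ⟨mul, hmul, mul_spec⟩ := hν.mul
  obtain ⟨o, ho⟩ := hν.surjective 1
  have hstep : Computable₂ fun (_ : List ℕ) (p : ℕ × ℕ) => mul p := hmul.comp .snd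
  refine ⟨_, Computable.list_foldr .id (.const o) hstep, fun l => ?_⟩
  induction l with
  | nil => simpa using ho
  | cons t l ih => simp_all

variable {ν} {α : Type*} [Primcodable α]

theorem codedIdeal_nil : codedIdeal ν [] = ⊥ := by simp [codedIdeal]

theorem codedIdeal_cons (k : ℕ) (q : List ℕ) :
    codedIdeal ν (k :: q) = Ideal.span {ν k} ⊔ codedIdeal ν q := by
  rw [codedIdeal, codedIdeal, ← Ideal.span_union]
  congr 1
  ext c
  simp [eq_comm]

theorem IsDetachable.computablePred (hdet : IsDetachable ν) {k : α → ℕ} {q : α → List ℕ}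
    (hk : Computable k) (hq : Computable q) :
    ComputablePred fun a => ν (k a) ∈ codedIdeal ν (q a) :=
  ComputablePred.comp (p := fun p : ℕ × List ℕ => ν p.1 ∈ codedIdeal ν p.2)
    (f := fun a => (k a, q a)) hdet (hk.pair hq)

theorem IsDetachable.mem (hdet : IsDetachable ν) {k : α → ℕ} {q : α → List ℕ}
    (hk : Computable k) (hq : Computable q) :
    IsSemidecidable fun a => ν (k a) ∈ codedIdeal ν (q a) :=
  .of_computablePred (hdet.computablePred hk hq)

theorem IsDetachable.notMem (hdet : IsDetachable ν) {k : α → ℕ} {q : α → List ℕ}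
    (hk : Computable k) (hq : Computable q) :
    IsSemidecidable fun a => ν (k a) ∉ codedIdeal ν (q a) :=
  .of_computablePred (hdet.computablePred hk hq).not

/-- Membership is tested coefficientwise, and only at the exponents listed in the code, since all
other coefficients are zero. -/
theorem isSemidecidable_mem_map_C (hν : IsEffectivePresentation ν) (hdet : IsDetachable ν)
    {p : α → PolyCode n} {q : α → List ℕ} (hp : Computable p) (hq : Computable q) :
    IsSemidecidable fun a => codedPoly ν (p a) ∈ (codedIdeal ν (q a)).map C := by
  obtain ⟨f, hf, f_spec⟩ := hν.exists_coeff (n := n)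
  have h : IsSemidecidable fun x : α × ((Fin n → ℕ) × ℕ) =>
      ν (f (p x.1, x.2.1)) ∈ codedIdeal ν (q x.1) :=
    hdet.mem (hf.comp ((hp.comp .fst).pair (Computable.fst.comp .snd))) (hq.comp .fst)
  refine (IsSemidecidable.forall_mem hp
    (p := fun a t => ν (f (p a, t.1)) ∈ codedIdeal ν (q a)) h).of_iff fun a => ?_
  simp only [f_spec, mem_map_C_iff]
  refine ⟨fun h t _ => h _, fun h γ => ?_⟩
  by_cases hγ : γ ∈ (codedPoly ν (p a)).support
  · obtain ⟨t, ht, rfl⟩ := exists_mem_of_mem_support_codedPoly ν hγ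
    exact h t ht
  · rw [notMem_support_iff.1 hγ]
    exact zero_mem _

theorem exists_list_of_mem_span (hν : IsEffectivePresentation ν) {T : Set (PolyCode n)}
    {f : MvPolynomial (Fin n) R} (hf : f ∈ Submodule.span R (codedPoly ν '' T)) :
    ∃ l : List (ℕ × PolyCode n), (∀ t ∈ l, t.2 ∈ T) ∧
      (l.map fun t => C (ν t.1) * codedPoly ν t.2).sum = f := by
  induction hf using Submodule.span_induction with
  | mem f hf =>
    obtain ⟨p, hp, rfl⟩ := hf
    obtain ⟨o, ho⟩ := hν.surjective 1
    exact ⟨[(o, p)], by simpa using hp, by simp [ho]⟩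
  | zero => exact ⟨[], by simp, by simp⟩
  | add f g _ _ hf hg =>
    obtain ⟨l, hl, rfl⟩ := hf
    obtain ⟨l', hl', rfl⟩ := hg
    exact ⟨l ++ l', fun t ht => (List.mem_append.1 ht).elim (hl t) (hl' t), by simp⟩
  | smul c f _ hf =>
    obtain ⟨l, hl, rfl⟩ := hf
    choose μ hμ using hν.surjective
    refine ⟨l.map fun t => (μ (c * ν t.1), t.2), ?_, ?_⟩
    · intro t ht
      obtain ⟨s, hs, rfl⟩ := List.mem_map.1 ht
      exact hl s hs
    · rw [List.smul_sum, List.map_map, List.map_map]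
      congr 2
      funext t
      simp [hμ, smul_eq_C_mul, mul_assoc]

/-- The combination is searched for as a finite list of coefficients and elements of `T`; whether it
is correct modulo `Q` is then checked on coefficients. -/
theorem isSemidecidable_mem_spanMod (hν : IsEffectivePresentation ν) (hdet : IsDetachable ν)
    {p : α → PolyCode n} {q : α → List ℕ} (hp : Computable p) (hq : Computable q)
    {T : α → PolyCode n → Prop} (hT : IsSemidecidable fun x : α × PolyCode n => T x.1 x.2) :
    IsSemidecidable fun a => codedPoly ν (p a) ∈
      spanMod (codedIdeal ν (q a)) (codedPoly ν '' {t | T a t}) := by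
  obtain ⟨f, hf, f_spec⟩ := hν.exists_linearCombination (n := n)
  have h1 : IsSemidecidable fun x : α × List (ℕ × PolyCode n) => ∀ t ∈ x.2, T x.1 t.2 :=
    IsSemidecidable.forall_mem .snd
      (p := fun (x : α × List (ℕ × PolyCode n)) (t : ℕ × PolyCode n) => T x.1 t.2)
      (hT.comp ((Computable.fst.comp .fst).pair (Computable.snd.comp .snd)))
  have h2 : IsSemidecidable fun x : α × List (ℕ × PolyCode n) =>
      codedPoly ν (p x.1 ++ f x.2) ∈ (codedIdeal ν (q x.1)).map C :=
    isSemidecidable_mem_map_C hν hdet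
      (Computable.list_append.comp (hp.comp .fst) (hf.comp .snd)) (hq.comp .fst)
  refine (IsSemidecidable.exists_ (p := fun a (l : List (ℕ × PolyCode n)) =>
    (∀ t ∈ l, T a t.2) ∧ codedPoly ν (p a ++ f l) ∈ (codedIdeal ν (q a)).map C)
    (h1.and h2)).of_iff fun a => ?_
  simp only [codedPoly_append, f_spec]
  constructor
  · intro h
    obtain ⟨s, hs, w, hw, hsw⟩ := Submodule.mem_sup.1 h
    -- The test adds the combination to `p a` instead of subtracting it, so the list must represent
    -- `-s`.
    obtain ⟨l, hl, hls⟩ := exists_list_of_mem_span hν (neg_mem hs)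
    refine ⟨l, hl, ?_⟩
    rw [hls, ← hsw, add_neg_cancel_comm]
    exact hw
  · rintro ⟨l, hl, h⟩
    rw [← add_sub_cancel_right (codedPoly ν (p a))
      (l.map fun t => C (ν t.1) * codedPoly ν t.2).sum]
    refine sub_mem (Submodule.mem_sup_right h) (Submodule.mem_sup_left ?_)
    refine list_sum_mem fun x hx => ?_
    obtain ⟨t, ht, rfl⟩ := List.mem_map.1 hx
    rw [← smul_eq_C_mul]
    exact Submodule.smul_mem _ _ (Submodule.subset_span ⟨_, hl t ht, rfl⟩)

/-! ### Codes of tagged polynomials -/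

/-- A code of a tagged polynomial. -/
abbrev TaggedCode (n : ℕ) : Type := PolyCode n × (Fin n → ℕ) × ℕ

variable (ν) in
/-- The tagged polynomial with a given code. -/
noncomputable def codedTagged (b : TaggedCode n) : TaggedPoly n R :=
  (codedPoly ν b.1, codedExp b.2.1, b.2.2)

variable (ν) in
/-- The finite set of tagged polynomials given by a list of codes. -/
def codedTaggedSet (G : List (TaggedCode n)) : Set (TaggedPoly n R) :=
  codedTagged ν '' {b | b ∈ G}

theorem codedTaggedSet_finite (G : List (TaggedCode n)) : (codedTaggedSet ν G).Finite :=
  (List.finite_toSet G).image _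

theorem fst_image_codedTaggedSet (G : List (TaggedCode n)) :
    Prod.fst '' codedTaggedSet ν G = codedPolySet ν (G.map Prod.fst) := by
  ext f
  simp [codedTaggedSet, codedPolySet, codedTagged]

theorem exists_codedTaggedSet_eq (hν : Function.Surjective ν) {B : Set (TaggedPoly n R)}
    (hB : B.Finite) : ∃ G, codedTaggedSet ν G = B := by
  have hsurj : Function.Surjective (codedTagged ν (n := n)) := by
    rintro ⟨f, e, d⟩
    obtain ⟨p, rfl⟩ := codedPoly_surjective hν f
    obtain ⟨a, rfl⟩ := exists_codedExp_eq e
    exact ⟨(p, a, d), rfl⟩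
  choose g hg using hsurj
  refine ⟨hB.toFinset.toList.map g, ?_⟩
  ext b
  constructor
  · rintro ⟨c, hc, rfl⟩
    obtain ⟨b, hb, rfl⟩ := List.mem_map.1 hc
    rw [hg]
    simpa using hb
  · intro hb
    exact ⟨g b, List.mem_map.2 ⟨b, by simpa using hb, rfl⟩, hg b⟩

/-- The relation `p = x^a g` between codes, for some `g` in a list. -/
theorem isSemidecidable_monomialMultiples {G : α → List (PolyCode n)} (hG : Computable G) :
    IsSemidecidable fun x : α × PolyCode n =>
      ∃ g ∈ G x.1, ∃ a, x.2 = monomialMulCode a g :=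
  IsSemidecidable.exists_mem (hG.comp .fst) (p := fun x g => ∃ a, x.2 = monomialMulCode a g)
    (IsSemidecidable.exists_ (p := fun (x : (α × PolyCode n) × PolyCode n) a =>
        x.1.2 = monomialMulCode a x.2)
      (.of_computablePred (computablePred_eq
        (Computable.snd.comp (Computable.fst.comp .fst))
        (Computable.monomialMulCode .snd (Computable.snd.comp .fst)))))

theorem image_codedPoly_monomialMultiples (G : List (PolyCode n)) :
    codedPoly ν '' {p | ∃ g ∈ G, ∃ a, p = monomialMulCode a g} =
      monomialMultiples (codedPolySet ν G) := by
  ext f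
  constructor
  · rintro ⟨_, ⟨g, hg, a, rfl⟩, rfl⟩
    exact ⟨_, ⟨g, hg, rfl⟩, codedExp a, codedPoly_monomialMulCode _ _ _⟩
  · rintro ⟨_, ⟨g, hg, rfl⟩, a, rfl⟩
    obtain ⟨a, rfl⟩ := exists_codedExp_eq a
    exact ⟨_, ⟨g, hg, a, rfl⟩, codedPoly_monomialMulCode _ _ _⟩

/-- With no generators for `Q`, membership modulo `Q` is equality: detachability supplies the test
for zero needed to confirm an identity in the polynomial ring. -/
theorem isSemidecidable_mem_ideal (hν : IsEffectivePresentation ν) (hdet : IsDetachable ν)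
    {p : α → PolyCode n} {F : α → List (PolyCode n)} (hp : Computable p) (hF : Computable F) :
    IsSemidecidable fun a => codedPoly ν (p a) ∈ codedPolyIdeal ν (F a) := by
  refine (isSemidecidable_mem_spanMod hν hdet hp (.const [])
    (T := fun a p => ∃ g ∈ F a, ∃ c, p = monomialMulCode c g)
    (isSemidecidable_monomialMultiples hF)).of_iff fun a => ?_
  rw [image_codedPoly_monomialMultiples, codedIdeal_nil, spanMod, monomialMultiples,
    span_monomial_mul, Ideal.map_bot, Submodule.restrictScalars_bot, sup_bot_eq]
  rfl

theorem isSemidecidable_gens (hν : IsEffectivePresentation ν) (hdet : IsDetachable ν)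
    {h : α → ℕ} {f : α → PolyCode n} {q : α → List ℕ} {G : α → List (TaggedCode n)}
    (hh : Computable h) (hf : Computable f) (hq : Computable q) (hG : Computable G) :
    IsSemidecidable fun a => C (ν (h a)) * codedPoly ν (f a) ∈
      spanMod (codedIdeal ν (q a)) (monomialMultiples (Prod.fst '' codedTaggedSet ν (G a))) := by
  obtain ⟨lc, hlc, lc_spec⟩ := hν.exists_linearCombination (n := n)
  refine (isSemidecidable_mem_spanMod hν hdet (p := fun a => lc [(h a, f a)])
    (hlc.comp (Computable.list_cons.comp (hh.pair hf) (.const []))) hq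
    (T := fun a p => ∃ g ∈ (G a).map Prod.fst, ∃ c, p = monomialMulCode c g)
    (isSemidecidable_monomialMultiples (Computable.list_map hG
      (Computable.fst.comp .snd).to₂))).of_iff fun a => ?_
  rw [image_codedPoly_monomialMultiples, lc_spec, fst_image_codedTaggedSet]
  simp

theorem isSemidecidable_pairs {r : (Fin n →₀ ℕ) → (Fin n →₀ ℕ) → Prop}
    (hdec : IsDecidableOrder r) (hν : IsEffectivePresentation ν) (hdet : IsDetachable ν)
    {h : α → ℕ} {b b' : α → TaggedCode n} {q : α → List ℕ} {G : α → List (TaggedCode n)}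
    (hh : Computable h) (hb : Computable b) (hb' : Computable b') (hq : Computable q)
    (hG : Computable G) :
    IsSemidecidable fun a =>
      C (ν (h a)) * TaggedPoly.pair (codedTagged ν (b a)) (codedTagged ν (b' a)) ∈
        spanMod (codedIdeal ν (q a)) (TaggedPoly.shifts (codedTaggedSet ν (G a))
          (fun γ => r γ (TaggedPoly.pairExp (codedTagged ν (b a)) (codedTagged ν (b' a))) ∧
            γ ≠ TaggedPoly.pairExp (codedTagged ν (b a)) (codedTagged ν (b' a)))
          (TaggedPoly.pairDegree (codedTagged ν (b a)) (codedTagged ν (b' a)))) := by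
  obtain ⟨lc, hlc, lc_spec⟩ := hν.exists_linearCombination (n := n)
  obtain ⟨cf, hcf, cf_spec⟩ := hν.exists_coeff (n := n)
  obtain ⟨mul, hmul, mul_spec⟩ := hν.mul
  obtain ⟨neg, hneg, neg_spec⟩ := hν.neg
  have hp : Computable Prod.fst (α := TaggedCode n) := .fst
  have he : Computable fun b : TaggedCode n => b.2.1 := Computable.fst.comp .snd
  have hd : Computable fun b : TaggedCode n => b.2.2 := Computable.snd.comp .snd
  have hs := Computable.exponent_sub (he.comp hb') (he.comp hb)
  have hs' := Computable.exponent_sub (he.comp hb) (he.comp hb')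
  -- `P`, `E` and `D` are computable versions of `h` times the S-polynomial, of `pairExp` and of
  -- `pairDegree`.
  let P (a : α) : PolyCode n :=
    lc [(mul (h a, cf ((b' a).1, (b' a).2.1)), monomialMulCode ((b' a).2.1 - (b a).2.1) (b a).1),
      (mul (h a, neg (cf ((b a).1, (b a).2.1))),
        monomialMulCode ((b a).2.1 - (b' a).2.1) (b' a).1)]
  have hP : Computable P := by
    refine hlc.comp (Computable.list_cons.comp ?_ (Computable.list_cons.comp ?_ (.const [])))
    · exact (hmul.comp (hh.pair (hcf.comp ((hp.comp hb').pair (he.comp hb'))))).pair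
        (Computable.monomialMulCode hs (hp.comp hb))
    · exact (hmul.comp (hh.pair (hneg.comp (hcf.comp ((hp.comp hb).pair (he.comp hb)))))).pair
        (Computable.monomialMulCode hs' (hp.comp hb'))
  let E (a : α) : Fin n → ℕ := ((b' a).2.1 - (b a).2.1) + (b a).2.1
  have hE : Computable E := Computable.exponent_add hs (he.comp hb)
  let D (a : α) : ℕ := max ((codedExp ((b' a).2.1 - (b a).2.1)).degree + (b a).2.2)
    ((codedExp ((b a).2.1 - (b' a).2.1)).degree + (b' a).2.2)
  have hD : Computable D := Primrec.nat_max.to_comp.comp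
    (Primrec.nat_add.to_comp.comp (Computable.degree_codedExp hs) (hd.comp hb))
    (Primrec.nat_add.to_comp.comp (Computable.degree_codedExp hs') (hd.comp hb'))
  let T (a : α) (p : PolyCode n) : Prop := ∃ g ∈ G a, ∃ c : Fin n → ℕ,
    p = monomialMulCode c g.1 ∧ (codedExp c).degree + g.2.2 ≤ D a ∧
      r (codedExp (c + g.2.1)) (codedExp (E a)) ∧ c + g.2.1 ≠ E a
  have hT : IsSemidecidable fun x : α × PolyCode n => T x.1 x.2 := by
    refine IsSemidecidable.exists_mem (hG.comp .fst)
      (p := fun x g => ∃ c : Fin n → ℕ, x.2 = monomialMulCode c g.1 ∧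
        (codedExp c).degree + g.2.2 ≤ D x.1 ∧
        r (codedExp (c + g.2.1)) (codedExp (E x.1)) ∧ c + g.2.1 ≠ E x.1) ?_
    refine IsSemidecidable.exists_ (p := fun (x : (α × PolyCode n) × TaggedCode n)
      (c : Fin n → ℕ) => x.1.2 = monomialMulCode c x.2.1 ∧
        (codedExp c).degree + x.2.2.2 ≤ D x.1.1 ∧
        r (codedExp (c + x.2.2.1)) (codedExp (E x.1.1)) ∧ c + x.2.2.1 ≠ E x.1.1) ?_
    have ha : Computable fun x : ((α × PolyCode n) × TaggedCode n) × (Fin n → ℕ) => x.1.1.1 :=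
      Computable.fst.comp (Computable.fst.comp .fst)
    have hg : Computable fun x : ((α × PolyCode n) × TaggedCode n) × (Fin n → ℕ) => x.1.2 :=
      Computable.snd.comp .fst
    have hc := Computable.exponent_add .snd (he.comp hg)
    refine .and (.of_computablePred (computablePred_eq
      (Computable.snd.comp (Computable.fst.comp .fst))
      (Computable.monomialMulCode .snd (hp.comp hg))))
      (.and (.of_computablePred (computablePred_le (Primrec.nat_add.to_comp.comp
        (Computable.degree_codedExp .snd) (hd.comp hg)) (hD.comp ha)))
      (.and (.of_computablePred (ComputablePred.comp hdec (hc.pair (hE.comp ha))))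
        (.of_computablePred (computablePred_eq hc (hE.comp ha)).not)))
  refine (isSemidecidable_mem_spanMod hν hdet hP hq hT).of_iff fun a => ?_
  have h1 : codedPoly ν (P a) =
      C (ν (h a)) * TaggedPoly.pair (codedTagged ν (b a)) (codedTagged ν (b' a)) := by
    simp only [P, lc_spec, List.map_cons, List.map_nil, List.sum_cons, List.sum_nil, mul_spec,
      neg_spec, cf_spec, codedPoly_monomialMulCode, codedExp_sub, TaggedPoly.pair, codedTagged,
      C_mul, C_neg]
    ring
  have h2 : TaggedPoly.pairExp (codedTagged ν (b a)) (codedTagged ν (b' a)) = codedExp (E a) := by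
    simp only [E, codedExp_add, codedExp_sub, TaggedPoly.pairExp, codedTagged]
  have h3 : TaggedPoly.pairDegree (codedTagged ν (b a)) (codedTagged ν (b' a)) = D a := by
    simp only [D, codedExp_sub, TaggedPoly.pairDegree, codedTagged]
  rw [h1, h2, h3]
  have h4 : TaggedPoly.shifts (codedTaggedSet ν (G a))
      (fun γ => r γ (codedExp (E a)) ∧ γ ≠ codedExp (E a)) (D a) =
      codedPoly ν '' {t | T a t} := by
    ext f
    constructor
    · rintro ⟨_, ⟨g, hg, rfl⟩, c, rfl, hcd, hcr, hce⟩
      obtain ⟨c, rfl⟩ := exists_codedExp_eq c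
      refine ⟨_, ⟨g, hg, c, rfl, hcd, ?_, ?_⟩, codedPoly_monomialMulCode _ _ _⟩
      · rw [codedExp_add]; exact hcr
      · rintro h
        exact hce (by rw [← h, codedExp_add]; rfl)
    · rintro ⟨_, ⟨g, hg, c, rfl, hcd, hcr, hce⟩, rfl⟩
      refine ⟨_, ⟨g, hg, rfl⟩, codedExp c, codedPoly_monomialMulCode _ _ _, hcd, ?_, ?_⟩
      · rw [codedExp_add] at hcr; exact hcr
      · intro h
        exact hce (codedExp_injective (by rw [← h, codedExp_add]; rfl))
  rw [h4]

end Codes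

/-! ### Confirming certificates by search -/

section Algorithms

open MvPolynomial

variable {n : ℕ} {R : Type u} [CommRing R] {ν : ℕ → R} {α : Type*} [Primcodable α]
  {r : (Fin n →₀ ℕ) → (Fin n →₀ ℕ) → Prop}

theorem isSemidecidable_lead (hν : IsEffectivePresentation ν) (hdet : IsDetachable ν)
    {h : α → ℕ} {b : α → TaggedCode n} {q : α → List ℕ}
    (hh : Computable h) (hb : Computable b) (hq : Computable q) :
    IsSemidecidable fun a => ∃ w, w * coeff (codedExp (b a).2.1) (codedPoly ν (b a).1) - ν (h a) ∈
      codedIdeal ν (q a) := by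
  obtain ⟨cf, hcf, cf_spec⟩ := hν.exists_coeff (n := n)
  obtain ⟨add, hadd, add_spec⟩ := hν.add
  obtain ⟨mul, hmul, mul_spec⟩ := hν.mul
  obtain ⟨neg, hneg, neg_spec⟩ := hν.neg
  have key : IsSemidecidable fun x : α × ℕ =>
      ν (add (mul (x.2, cf ((b x.1).1, (b x.1).2.1)), neg (h x.1))) ∈ codedIdeal ν (q x.1) := by
    refine hdet.mem (hadd.comp (.pair (hmul.comp (.pair .snd (hcf.comp (.pair ?_ ?_))))
      (hneg.comp (hh.comp .fst)))) (hq.comp .fst)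
    · exact Computable.fst.comp (hb.comp .fst)
    · exact Computable.fst.comp (Computable.snd.comp (hb.comp .fst))
  refine (IsSemidecidable.exists_ (p := fun a (w : ℕ) =>
    ν (add (mul (w, cf ((b a).1, (b a).2.1)), neg (h a))) ∈ codedIdeal ν (q a)) key).of_iff
    fun a => ?_
  simp only [add_spec, mul_spec, neg_spec, cf_spec, ← sub_eq_add_neg]
  exact hν.surjective.exists

theorem isSemidecidable_below (hdec : IsDecidableOrder r) (hν : IsEffectivePresentation ν)
    (hdet : IsDetachable ν) {b : α → TaggedCode n} {q : α → List ℕ}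
    (hb : Computable b) (hq : Computable q) :
    IsSemidecidable fun a => ∀ γ ∈ (codedPoly ν (b a).1).support,
      coeff γ (codedPoly ν (b a).1) ∈ codedIdeal ν (q a) ∨ r γ (codedExp (b a).2.1) := by
  obtain ⟨cf, hcf, cf_spec⟩ := hν.exists_coeff (n := n)
  have hp : Computable fun a => (b a).1 := Computable.fst.comp hb
  have he : Computable fun a => (b a).2.1 := Computable.fst.comp (Computable.snd.comp hb)
  have ht : Computable fun x : α × ((Fin n → ℕ) × ℕ) => x.2.1 := Computable.fst.comp .snd
  have h1 : IsSemidecidable fun x : α × ((Fin n → ℕ) × ℕ) =>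
      ν (cf ((b x.1).1, x.2.1)) ∈ codedIdeal ν (q x.1) :=
    hdet.mem (hcf.comp ((hp.comp .fst).pair ht)) (hq.comp .fst)
  have h2 : IsSemidecidable fun x : α × ((Fin n → ℕ) × ℕ) =>
      r (codedExp x.2.1) (codedExp (b x.1).2.1) :=
    .of_computablePred (ComputablePred.comp (p := fun p : (Fin n → ℕ) × (Fin n → ℕ) =>
      r (codedExp p.1) (codedExp p.2)) (f := fun x : α × ((Fin n → ℕ) × ℕ) =>
      (x.2.1, (b x.1).2.1)) hdec (ht.pair (he.comp .fst)))
  refine (IsSemidecidable.forall_mem hp (p := fun a t =>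
    ν (cf ((b a).1, t.1)) ∈ codedIdeal ν (q a) ∨ r (codedExp t.1) (codedExp (b a).2.1))
    (h1.or h2)).of_iff fun a => ?_
  simp only [cf_spec]
  constructor
  -- A listed term may cancel in the polynomial; its exponent is then outside the support, but the
  -- zero coefficient lies in `Q`.
  · intro h t _
    by_cases hγ : codedExp t.1 ∈ (codedPoly ν (b a).1).support
    · exact h _ hγ
    · rw [notMem_support_iff.1 hγ]
      exact .inl (zero_mem _)
  · intro h γ hγ
    obtain ⟨t, ht, rfl⟩ := exists_mem_of_mem_support_codedPoly ν hγ
    exact h t ht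

theorem isSemidecidable_isCertificate (hdec : IsDecidableOrder r)
    (hν : IsEffectivePresentation ν) (hdet : IsDetachable ν)
    {h : α → ℕ} {F : α → List (PolyCode n)} {q : α → List ℕ} {G : α → List (TaggedCode n)}
    (hh : Computable h) (hF : Computable F) (hq : Computable q) (hG : Computable G) :
    IsSemidecidable fun a => IsCertificate r (codedPolySet ν (F a)) (codedIdeal ν (q a))
      (codedTaggedSet ν (G a)) (ν (h a)) := by
  have hb : Computable fun x : α × TaggedCode n => x.2 := .snd
  have h1 : IsSemidecidable fun a => ∃ b ∈ G a, True :=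
    .exists_mem hG (p := fun _ _ => True) (.of_computablePred ⟨inferInstance, .const _⟩)
  have h2 : IsSemidecidable fun a => ∀ b ∈ G a, codedPoly ν b.1 ∈ codedPolyIdeal ν (F a) :=
    .forall_mem hG (p := fun a b => codedPoly ν b.1 ∈ codedPolyIdeal ν (F a))
      (isSemidecidable_mem_ideal hν hdet (Computable.fst.comp hb) (hF.comp .fst))
  have h3 : IsSemidecidable fun a => ∀ b ∈ G a, ∃ w, w * coeff (codedExp b.2.1) (codedPoly ν b.1) -
      ν (h a) ∈ codedIdeal ν (q a) :=
    .forall_mem hG (p := fun a b => ∃ w, w * coeff (codedExp b.2.1) (codedPoly ν b.1) -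
      ν (h a) ∈ codedIdeal ν (q a))
      (isSemidecidable_lead hν hdet (hh.comp .fst) hb (hq.comp .fst))
  have h4 : IsSemidecidable fun a => ∀ b ∈ G a, ∀ γ ∈ (codedPoly ν b.1).support,
      coeff γ (codedPoly ν b.1) ∈ codedIdeal ν (q a) ∨ r γ (codedExp b.2.1) :=
    .forall_mem hG (p := fun a b => ∀ γ ∈ (codedPoly ν b.1).support,
      coeff γ (codedPoly ν b.1) ∈ codedIdeal ν (q a) ∨ r γ (codedExp b.2.1))
      (isSemidecidable_below hdec hν hdet hb (hq.comp .fst))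
  have h5 : IsSemidecidable fun a => ∀ b ∈ G a, (codedExp b.2.1).degree ≤ b.2.2 :=
    .forall_mem hG (p := fun _ b => (codedExp b.2.1).degree ≤ b.2.2)
      (.of_computablePred (computablePred_le
        (Computable.degree_codedExp (Computable.fst.comp (Computable.snd.comp hb)))
        (Computable.snd.comp (Computable.snd.comp hb))))
  let P (a : α) (b b' : TaggedCode n) : Prop :=
    C (ν (h a)) * TaggedPoly.pair (codedTagged ν b) (codedTagged ν b') ∈
      spanMod (codedIdeal ν (q a)) (TaggedPoly.shifts (codedTaggedSet ν (G a))
        (fun γ => r γ (TaggedPoly.pairExp (codedTagged ν b) (codedTagged ν b')) ∧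
          γ ≠ TaggedPoly.pairExp (codedTagged ν b) (codedTagged ν b'))
        (TaggedPoly.pairDegree (codedTagged ν b) (codedTagged ν b')))
  have h6 : IsSemidecidable fun a => ∀ b ∈ G a, ∀ b' ∈ G a, P a b b' := by
    refine .forall_mem hG (p := fun a b => ∀ b' ∈ G a, P a b b') ?_
    refine .forall_mem (hG.comp .fst) (p := fun (x : α × TaggedCode n) b' => P x.1 x.2 b') ?_
    have ha : Computable fun x : (α × TaggedCode n) × TaggedCode n => x.1.1 :=
      Computable.fst.comp .fst
    exact isSemidecidable_pairs hdec hν hdet (hh.comp ha) (Computable.snd.comp .fst) .snd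
      (hq.comp ha) (hG.comp ha)
  have h7 : IsSemidecidable fun a => ∀ f ∈ F a, C (ν (h a)) * codedPoly ν f ∈
      spanMod (codedIdeal ν (q a)) (monomialMultiples (Prod.fst '' codedTaggedSet ν (G a))) :=
    .forall_mem hF (p := fun a f => C (ν (h a)) * codedPoly ν f ∈
      spanMod (codedIdeal ν (q a)) (monomialMultiples (Prod.fst '' codedTaggedSet ν (G a))))
      (isSemidecidable_gens hν hdet (hh.comp .fst) .snd (hq.comp .fst) (hG.comp .fst))
  refine (h1.and (h2.and (h3.and (h4.and (h5.and (h6.and h7)))))).of_iff fun a => ?_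
  constructor
  · intro H
    refine ⟨?_, fun b hb => H.mem _ ⟨b, hb, rfl⟩, fun b hb => H.lead _ ⟨b, hb, rfl⟩,
      fun b hb => H.below _ ⟨b, hb, rfl⟩, fun b hb => H.degree_le _ ⟨b, hb, rfl⟩,
      fun b hb b' hb' => H.pairs _ ⟨b, hb, rfl⟩ _ ⟨b', hb', rfl⟩,
      fun f hf => H.gens _ ⟨f, hf, rfl⟩⟩
    obtain ⟨_, b, hb, -⟩ := H.nonempty
    exact ⟨b, hb, trivial⟩
  · rintro ⟨⟨b, hb, -⟩, H2, H3, H4, H5, H6, H7⟩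
    refine ⟨⟨_, b, hb, rfl⟩, ?_, ?_, ?_, ?_, ?_, ?_⟩
    · rintro _ ⟨b, hb, rfl⟩
      exact H2 b hb
    · rintro _ ⟨b, hb, rfl⟩
      exact H3 b hb
    · rintro _ ⟨b, hb, rfl⟩
      exact H4 b hb
    · rintro _ ⟨b, hb, rfl⟩
      exact H5 b hb
    · rintro _ ⟨b, hb, rfl⟩ _ ⟨b', hb', rfl⟩
      exact H6 b hb b' hb'
    · rintro _ ⟨f, hf, rfl⟩
      exact H7 f hf

/-! ## Generic standard bases -/

variable (ν r) in
/-- The tagged polynomials `G` and the elements `H` outside of the ideal `Q` form a certified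
generic standard basis modulo `Q`; when the product of the elements of `H` lies in `Q`, the
stratum is empty and no polynomial is needed. -/
structure IsGenericBasis (F : List (PolyCode n)) (q : List ℕ) (G : List (TaggedCode n))
    (H : List ℕ) : Prop where
  notMem : ∀ k ∈ H, ν k ∉ codedIdeal ν q
  cert : (G = [] ∧ (H.map ν).prod ∈ codedIdeal ν q) ∨
    IsCertificate r (codedPolySet ν F) (codedIdeal ν q) (codedTaggedSet ν G) (H.map ν).prod

theorem isSemidecidable_isGenericBasis (hdec : IsDecidableOrder r)
    (hν : IsEffectivePresentation ν) (hdet : IsDetachable ν)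
    {F : α → List (PolyCode n)} {q H : α → List ℕ} {G : α → List (TaggedCode n)}
    (hF : Computable F) (hq : Computable q) (hG : Computable G) (hH : Computable H) :
    IsSemidecidable fun a => IsGenericBasis ν r (F a) (q a) (G a) (H a) := by
  obtain ⟨prod, hprod, prod_spec⟩ := hν.exists_prod
  have h1 : IsSemidecidable fun a => ∀ k ∈ H a, ν k ∉ codedIdeal ν (q a) :=
    .forall_mem hH (p := fun a k => ν k ∉ codedIdeal ν (q a)) (hdet.notMem .snd (hq.comp .fst))
  have h2 : IsSemidecidable fun a => G a = [] :=
    .of_computablePred (computablePred_eq hG (.const []))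
  refine (h1.and ((h2.and (hdet.mem (hprod.comp hH) hq)).or
    (isSemidecidable_isCertificate hdec hν hdet (hprod.comp hH) hF hq hG))).of_iff fun a => ?_
  simp only [prod_spec]
  exact ⟨fun h => ⟨h.1, h.2⟩, fun h => ⟨h.1, h.2⟩⟩

/-- For prime `Q` there is a certificate with a single `h`. Otherwise `Q` is proper, by the
hypothesis on the polynomials, and two elements witnessing that it is not prime describe an empty
stratum. -/
theorem exists_isGenericBasis (hr : IsMonomialOrder r) (hν : Function.Surjective ν)
    {F : List (PolyCode n)} {q : List ℕ}
    (hJ : ¬ codedPolyIdeal ν F ≤ (codedIdeal ν q).map C) :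
    ∃ G H, IsGenericBasis ν r F q G H := by
  by_cases hQ : (codedIdeal ν q).IsPrime
  · have hFfin : (codedPolySet ν F).Finite := (List.finite_toSet F).image _
    have hFQ : ∃ f ∈ codedPolySet ν F, f ∉ (codedIdeal ν q).map C := by
      by_contra! h
      exact hJ (Ideal.span_le.2 h)
    obtain ⟨B, hB, h, hh, hcert⟩ := exists_isCertificate hr hFfin hFQ
    obtain ⟨G, rfl⟩ := exists_codedTaggedSet_eq hν hB
    obtain ⟨k, rfl⟩ := hν h
    exact ⟨G, [k], by simpa using hh, .inr (by simpa using hcert)⟩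
  · have htop : codedIdeal ν q ≠ ⊤ := fun h => hJ (by rw [h, Ideal.map_top]; exact le_top)
    obtain ⟨x, hx, y, hy, hxy⟩ := (Ideal.not_isPrime_iff.1 hQ).resolve_left htop
    obtain ⟨k, rfl⟩ := hν x
    obtain ⟨l, rfl⟩ := hν y
    exact ⟨[], [k, l], by simp [hx, hy], .inl ⟨rfl, by simpa using hxy⟩⟩

theorem IsGenericBasis.isParametricBasis (hr : IsMonomialOrder r) {F : List (PolyCode n)}
    {q : List ℕ} {G : List (TaggedCode n)} {H : List ℕ} (h : IsGenericBasis ν r F q G H) :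
    IsParametricBasis.{u, v} r (codedPolyIdeal ν F) (codedIdeal ν q)
      (codedPolySet ν (G.map Prod.fst)) (H.map ν) := by
  refine ⟨(List.finite_toSet _).image _, ?_, by simpa using h.notMem, ?_⟩
  · rintro _ ⟨p, hp, rfl⟩
    obtain ⟨b, hb, rfl⟩ := List.mem_map.1 hp
    rcases h.cert with ⟨rfl, -⟩ | hc
    · simp at hb
    · exact hc.mem _ ⟨b, hb, rfl⟩
  · rcases h.cert with ⟨-, hm⟩ | hc
    -- No specialization kills `Q` while keeping nonzero an element of `Q`, so the requirements are
    -- vacuous.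
    · exact ⟨fun K _ σ hσ hne => absurd (hσ _ hm) hne,
        fun _ _ => ⟨0, fun K _ σ hσ hne => absurd (hσ _ hm) hne⟩⟩
    · rw [← fst_image_codedTaggedSet]
      exact hc.specializesToStandardBasis hr (codedTaggedSet_finite G)

theorem exists_computable_parametricBasis (hr : IsMonomialOrder r) (hdec : IsDecidableOrder r)
    (hν : IsEffectivePresentation ν) (hdet : IsDetachable ν) :
    ∃ A : List (PolyCode n) × List ℕ → List (PolyCode n) × List ℕ, Computable A ∧
      ∀ (F : List (PolyCode n)) (q : List ℕ),
        ¬ codedPolyIdeal ν F ≤ (codedIdeal ν q).map MvPolynomial.C →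
        IsParametricBasis.{u, v} r (codedPolyIdeal ν F) (codedIdeal ν q)
          (codedPolySet ν (A (F, q)).1) ((A (F, q)).2.map ν) := by
  -- The first alternative, which is confirmed on generators, makes the relation total, so that the
  -- search also stops on inputs with `J` contained in the extension of `Q`.
  let S (x : List (PolyCode n) × List ℕ) (y : List (TaggedCode n) × List ℕ) : Prop :=
    (∀ f ∈ x.1, codedPoly ν f ∈ (codedIdeal ν x.2).map C) ∨ IsGenericBasis ν r x.1 x.2 y.1 y.2
  have hS : IsSemidecidable fun z : (List (PolyCode n) × List ℕ) ×
      (List (TaggedCode n) × List ℕ) => S z.1 z.2 := by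
    refine .or (.forall_mem (Computable.fst.comp .fst)
      (p := fun (z : (List (PolyCode n) × List ℕ) × (List (TaggedCode n) × List ℕ)) f =>
        codedPoly ν f ∈ (codedIdeal ν z.1.2).map C)
      (isSemidecidable_mem_map_C hν hdet .snd
        (Computable.snd.comp (Computable.fst.comp .fst)))) ?_
    exact isSemidecidable_isGenericBasis hdec hν hdet (Computable.fst.comp .fst)
      (Computable.snd.comp .fst) (Computable.fst.comp .snd) (Computable.snd.comp .snd)
  have hle : ∀ {F : List (PolyCode n)} {q : List ℕ},
      (∀ f ∈ F, codedPoly ν f ∈ (codedIdeal ν q).map C) →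
      codedPolyIdeal ν F ≤ (codedIdeal ν q).map C := by
    intro F q h
    refine Ideal.span_le.2 ?_
    rintro _ ⟨f, hf, rfl⟩
    exact h f hf
  obtain ⟨A, hA, hAS⟩ := hS.exists_computable (R := S) (by
    rintro ⟨F, q⟩
    by_cases hJ : codedPolyIdeal ν F ≤ (codedIdeal ν q).map C
    · exact ⟨([], []), .inl fun f hf => hJ (Ideal.subset_span ⟨f, hf, rfl⟩)⟩
    · obtain ⟨G, H, h⟩ := exists_isGenericBasis hr hν.surjective hJ
      exact ⟨(G, H), .inr h⟩)
  refine ⟨fun x => ((A x).1.map Prod.fst, (A x).2),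
    (Computable.list_map (Computable.fst.comp hA) (Computable.fst.comp .snd).to₂).pair
      (Computable.snd.comp hA), fun F q hJ => ?_⟩
  exact ((hAS (F, q)).resolve_left fun h => hJ (hle h)).isParametricBasis hr

/-! ## Stratifications -/

/-- A node of a decision tree: generators of an ideal, and a generic basis modulo this ideal. -/
abbrev NodeCode (n : ℕ) : Type := List ℕ × List (TaggedCode n) × List ℕ

/-- `q` is an inner node or a leaf. -/
def IsNode (N : List (NodeCode n)) (L : List (List ℕ)) (q : List ℕ) : Prop :=
  (∃ l ∈ L, l = q) ∨ ∃ t ∈ N, t.1 = q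

variable (ν r) in
/-- `N` and `L` are the inner nodes and the leaves of a decision tree for the ideal
generated by `F`: the polynomials vanish modulo the leaves, and below each inner node there
is a branch for each of the elements to be inverted there. -/
structure IsTree (F : List (PolyCode n)) (N : List (NodeCode n)) (L : List (List ℕ)) : Prop where
  generic : ∀ t ∈ N, IsGenericBasis ν r F t.1 t.2.1 t.2.2
  branch : ∀ t ∈ N, ∀ k ∈ t.2.2, IsNode N L (k :: t.1)
  leaf : ∀ q ∈ L, ∀ f ∈ F, codedPoly ν f ∈ (codedIdeal ν q).map C

theorem IsNode.mono {N N' : List (NodeCode n)} {L L' : List (List ℕ)} {q : List ℕ}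
    (h : IsNode N L q) (hN : N ⊆ N') (hL : L ⊆ L') : IsNode N' L' q :=
  h.imp (fun ⟨l, hl, h⟩ => ⟨l, hL hl, h⟩) fun ⟨t, ht, h⟩ => ⟨t, hN ht, h⟩

theorem IsTree.append {F : List (PolyCode n)} {N N' : List (NodeCode n)} {L L' : List (List ℕ)}
    (h : IsTree ν r F N L) (h' : IsTree ν r F N' L') : IsTree ν r F (N ++ N') (L ++ L') := by
  refine ⟨fun t ht => ?_, fun t ht k hk => ?_, fun q hq => ?_⟩
  · exact (List.mem_append.1 ht).elim (h.generic t) (h'.generic t)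
  · rcases List.mem_append.1 ht with ht | ht
    · exact (h.branch t ht k hk).mono (List.subset_append_left _ _) (List.subset_append_left _ _)
    · exact (h'.branch t ht k hk).mono (List.subset_append_right _ _)
        (List.subset_append_right _ _)
  · exact (List.mem_append.1 hq).elim (h.leaf q) (h'.leaf q)

theorem lt_codedIdeal_cons {k : ℕ} {q : List ℕ} (h : ν k ∉ codedIdeal ν q) :
    codedIdeal ν q < codedIdeal ν (k :: q) := by
  rw [codedIdeal_cons]
  exact right_lt_sup.2 fun hle => h (hle (Ideal.mem_span_singleton_self _))

/-- Noetherian induction on the ideal at the node: each element to be inverted lies outside it, so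
every branch leads to a strictly larger ideal. -/
theorem exists_isTree [IsNoetherianRing R] (hr : IsMonomialOrder r)
    (hν : Function.Surjective ν) (F : List (PolyCode n)) (q : List ℕ) :
    ∃ N L, IsTree ν r F N L ∧ IsNode N L q := by
  induction hQ : codedIdeal ν q using WellFoundedGT.induction generalizing q with
  | ind Q ih =>
    subst hQ
    by_cases hJ : ∀ f ∈ F, codedPoly ν f ∈ (codedIdeal ν q).map C
    · exact ⟨[], [q], ⟨by simp, by simp, by simpa using hJ⟩, .inl (by simp)⟩
    · obtain ⟨G, H, hGH⟩ := exists_isGenericBasis (r := r) hr hν (F := F) (q := q)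
        fun hle => hJ fun f hf => hle (Ideal.subset_span ⟨f, hf, rfl⟩)
      -- The subtrees of the branches are merged one at a time by concatenating their nodes and
      -- leaves.
      have hex : ∀ H' : List ℕ, (∀ k ∈ H', ν k ∉ codedIdeal ν q) →
          ∃ N L, IsTree ν r F N L ∧ ∀ k ∈ H', IsNode N L (k :: q) := by
        intro H'
        induction H' with
        | nil => exact fun _ => ⟨[], [], ⟨by simp, by simp, by simp⟩, by simp⟩
        | cons k H' ihH =>
          intro hk
          obtain ⟨N, L, hNL, hH'⟩ := ihH fun k' hk' => hk k' (List.mem_cons_of_mem _ hk')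
          obtain ⟨N', L', hNL', hk'⟩ := ih _ (lt_codedIdeal_cons (hk k List.mem_cons_self)) _ rfl
          refine ⟨N ++ N', L ++ L', hNL.append hNL', fun k'' hk'' => ?_⟩
          rcases List.mem_cons.1 hk'' with rfl | hk''
          · exact hk'.mono (List.subset_append_right _ _) (List.subset_append_right _ _)
          · exact (hH' k'' hk'').mono (List.subset_append_left _ _) (List.subset_append_left _ _)
      obtain ⟨N, L, hNL, hH⟩ := hex H hGH.notMem
      refine ⟨(q, G, H) :: N, L, ⟨?_, ?_, hNL.leaf⟩, .inr ⟨_, List.mem_cons_self, rfl⟩⟩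
      · intro t ht
        rcases List.mem_cons.1 ht with rfl | ht
        exacts [hGH, hNL.generic t ht]
      · intro t ht k hk
        rcases List.mem_cons.1 ht with rfl | ht
        · exact (hH k hk).mono (List.subset_cons_self _ _) (List.Subset.refl _)
        · exact (hNL.branch t ht k hk).mono (List.subset_cons_self _ _) (List.Subset.refl _)

/-- The ideal of all coefficients of the generators: a specialization killing it kills the
polynomials, and it lies in every ideal modulo which they vanish. -/
theorem exists_coeff_list (hν : Function.Surjective ν) (F : List (PolyCode n)) :
    ∃ I : List ℕ, (∀ f ∈ F, codedPoly ν f ∈ (codedIdeal ν I).map C) ∧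
      ∀ k ∈ I, ∃ f ∈ F, ∃ γ, ν k = coeff γ (codedPoly ν f) := by
  choose μ hμ using hν
  refine ⟨F.flatMap fun f => (codedPoly ν f).support.toList.map fun γ =>
    μ (coeff γ (codedPoly ν f)), fun f hf => mem_map_C_iff.2 fun γ => ?_, fun k hk => ?_⟩
  · by_cases hγ : γ ∈ (codedPoly ν f).support
    · exact Ideal.subset_span ⟨_, List.mem_flatMap.2 ⟨f, hf, List.mem_map.2
        ⟨γ, Finset.mem_toList.2 hγ, rfl⟩⟩, hμ _⟩
    · rw [notMem_support_iff.1 hγ]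
      exact zero_mem _
  · obtain ⟨f, hf, hk⟩ := List.mem_flatMap.1 hk
    obtain ⟨γ, -, rfl⟩ := List.mem_map.1 hk
    exact ⟨f, hf, γ, hμ _⟩

theorem exists_mem_of_list_prod_mem {P : Ideal R} (hP : P.IsPrime) {l : List R}
    (h : l.prod ∈ P) : ∃ x ∈ l, x ∈ P := by
  induction l with
  | nil => exact absurd ((Ideal.eq_top_iff_one _).2 (by simpa using h)) hP.ne_top
  | cons a l ih =>
    rw [List.prod_cons] at h
    rcases hP.mem_or_mem h with h | h
    · exact ⟨a, List.mem_cons_self, h⟩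
    · obtain ⟨x, hx, hxP⟩ := ih h
      exact ⟨x, List.mem_cons_of_mem _ hx, hxP⟩

/-- The prime descends the tree: if it contains the product at a node, it contains a factor and
hence the ideal of that branch. The ideals grow strictly, so the descent ends at a node whose
product it avoids, or at a leaf, which contains `I`. -/
theorem IsTree.mem_cover [IsNoetherianRing R] {F : List (PolyCode n)} {N : List (NodeCode n)}
    {L : List (List ℕ)} (h : IsTree ν r F N L) {I : Ideal R}
    (hI : ∀ q ∈ L, I ≤ codedIdeal ν q) (p : PrimeSpectrum R) (q : List ℕ) (hq : IsNode N L q)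
    (hp : codedIdeal ν q ≤ p.asIdeal) :
    (∃ t ∈ N, codedIdeal ν t.1 ≤ p.asIdeal ∧ (t.2.2.map ν).prod ∉ p.asIdeal) ∨
      I ≤ p.asIdeal := by
  induction hQ : codedIdeal ν q using WellFoundedGT.induction generalizing q with
  | ind Q ih =>
    subst hQ
    rcases hq with ⟨_, hq, rfl⟩ | ⟨t, ht, rfl⟩
    · exact .inr ((hI _ hq).trans hp)
    · by_cases hm : (t.2.2.map ν).prod ∈ p.asIdeal
      · obtain ⟨x, hx, hxp⟩ := exists_mem_of_list_prod_mem p.isPrime hm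
        obtain ⟨k, hk, rfl⟩ := List.mem_map.1 hx
        refine ih _ (lt_codedIdeal_cons ((h.generic t ht).notMem k hk)) _ (h.branch t ht k hk) ?_ rfl
        rw [codedIdeal_cons]
        exact sup_le ((Ideal.span_singleton_le_iff_mem _).2 hxp) hp
      · exact .inl ⟨t, ht, hp, hm⟩

theorem IsTree.isStratification [IsNoetherianRing R] (hr : IsMonomialOrder r)
    {F : List (PolyCode n)} {N : List (NodeCode n)} {L : List (List ℕ)} (h : IsTree ν r F N L)
    (hroot : IsNode N L []) {I : List ℕ} (hI : ∀ q ∈ L, ∀ k ∈ I, ν k ∈ codedIdeal ν q)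
    (hFI : ∀ f ∈ F, codedPoly ν f ∈ (codedIdeal ν I).map C) {prod : List ℕ → ℕ}
    (hprod : ∀ l, ν (prod l) = (l.map ν).prod) :
    IsStratification.{u, v} r (codedPolyIdeal ν F)
      (codedTriples ν (N.map fun t => (t.2.1.map Prod.fst, t.1, prod t.2.2)))
      (codedIdeal ν I) := by
  have hT : ∀ t ∈ codedTriples ν (N.map fun t => (t.2.1.map Prod.fst, t.1, prod t.2.2)),
      ∃ H : List ℕ, IsParametricBasis.{u, v} r (codedPolyIdeal ν F) t.2.1 t.1 (H.map ν) ∧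
        t.2.2 = (H.map ν).prod := by
    rintro _ ⟨s, hs, rfl⟩
    obtain ⟨t, ht, rfl⟩ := List.mem_map.1 hs
    exact ⟨t.2.2, (h.generic t ht).isParametricBasis hr, hprod _⟩
  refine ⟨(List.finite_toSet _).image _, ?_, ?_, ?_, ?_, ?_, ?_⟩
  · intro t ht
    obtain ⟨H, hH, -⟩ := hT t ht
    exact hH.finite
  · intro t ht
    obtain ⟨H, hH, -⟩ := hT t ht
    exact hH.subset
  · refine (Set.eq_univ_of_forall fun p => ?_).symm
    have hI' : ∀ q ∈ L, codedIdeal ν I ≤ codedIdeal ν q := by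
      intro q hq
      refine Ideal.span_le.2 ?_
      rintro _ ⟨k, hk, rfl⟩
      exact hI q hq k hk
    rcases h.mem_cover hI' p [] hroot (by rw [codedIdeal_nil]; exact bot_le) with
      ⟨t, ht, hp, hm⟩ | hp
    · refine .inl (Set.mem_iUnion₂.2 ⟨_, ⟨_, List.mem_map.2 ⟨t, ht, rfl⟩, rfl⟩, hp, ?_⟩)
      rw [PrimeSpectrum.mem_zeroLocus, Set.singleton_subset_iff]
      rw [SetLike.mem_coe, hprod]
      exact hm
    · exact .inr hp
  · intro K _ σ hσ f hf
    refine map_eq_zero_of_mem_map_C hσ ((Ideal.span_le.2 ?_ : codedPolyIdeal ν F ≤ _) hf)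
    rintro _ ⟨p, hp, rfl⟩
    exact hFI p hp
  · intro t ht K _ σ hσ hne
    obtain ⟨H, hH, hprod⟩ := hT t ht
    -- A standard basis exists only for a nonzero ideal, so some element of `J` survives on the
    -- stratum.
    have hbot := (hH.spec.1 K σ hσ (hprod ▸ hne)).ne_bot
    by_contra! hzero
    refine hbot (le_bot_iff.1 (Ideal.map_le_iff_le_comap.2 fun f hf => ?_))
    rw [Ideal.mem_comap, Ideal.mem_bot]
    exact hzero f hf
  · intro t ht
    obtain ⟨H, hH, hprod⟩ := hT t ht
    rw [hprod]
    exact hH.spec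

theorem exists_computable_stratification [IsNoetherianRing R] (hr : IsMonomialOrder r)
    (hdec : IsDecidableOrder r) (hν : IsEffectivePresentation ν) (hdet : IsDetachable ν) :
    ∃ A : List (PolyCode n) → TriplesCode n × List ℕ, Computable A ∧
      ∀ F : List (PolyCode n), IsStratification.{u, v} r (codedPolyIdeal ν F)
        (codedTriples ν (A F).1) (codedIdeal ν (A F).2) := by
  obtain ⟨prod, hprod, prod_spec⟩ := hν.exists_prod
  -- The object searched for is a whole tree rooted at the zero ideal, together with generators of
  -- an ideal lying between the coefficients of `F` and all leaves.
  let S (F : List (PolyCode n)) (y : List (NodeCode n) × List (List ℕ) × List ℕ) : Prop :=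
    (∀ t ∈ y.1, IsGenericBasis ν r F t.1 t.2.1 t.2.2) ∧
    (∀ t ∈ y.1, ∀ k ∈ t.2.2, IsNode y.1 y.2.1 (k :: t.1)) ∧
    (∀ q ∈ y.2.1, ∀ f ∈ F, codedPoly ν f ∈ (codedIdeal ν q).map C) ∧
    IsNode y.1 y.2.1 [] ∧
    (∀ q ∈ y.2.1, ∀ k ∈ y.2.2, ν k ∈ codedIdeal ν q) ∧
    (∀ f ∈ F, codedPoly ν f ∈ (codedIdeal ν y.2.2).map C)
  have hnode : ∀ {β : Type} [Primcodable β] {N : β → List (NodeCode n)} {L : β → List (List ℕ)}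
      {q : β → List ℕ}, Computable N → Computable L → Computable q →
      IsSemidecidable fun b => IsNode (N b) (L b) (q b) := by
    intro β _ N L q hN hL hq
    exact .or (.exists_mem hL (p := fun b l => l = q b)
      (.of_computablePred (computablePred_eq .snd (hq.comp .fst))))
      (.exists_mem hN (p := fun b t => t.1 = q b)
      (.of_computablePred (computablePred_eq (Computable.fst.comp .snd) (hq.comp .fst))))
  have hS : IsSemidecidable fun z : List (PolyCode n) ×
      (List (NodeCode n) × List (List ℕ) × List ℕ) => S z.1 z.2 := by
    let Z := List (PolyCode n) × (List (NodeCode n) × List (List ℕ) × List ℕ)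
    have hF : Computable fun z : Z => z.1 := .fst
    have hN : Computable fun z : Z => z.2.1 := Computable.fst.comp .snd
    have hL : Computable fun z : Z => z.2.2.1 := Computable.fst.comp (Computable.snd.comp .snd)
    have hI : Computable fun z : Z => z.2.2.2 := Computable.snd.comp (Computable.snd.comp .snd)
    have h1 : IsSemidecidable fun z : Z => ∀ t ∈ z.2.1, IsGenericBasis ν r z.1 t.1 t.2.1 t.2.2 :=
      .forall_mem hN (p := fun (z : Z) t => IsGenericBasis ν r z.1 t.1 t.2.1 t.2.2)
        (isSemidecidable_isGenericBasis hdec hν hdet (hF.comp .fst) (Computable.fst.comp .snd)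
          (Computable.fst.comp (Computable.snd.comp .snd))
          (Computable.snd.comp (Computable.snd.comp .snd)))
    have h2 : IsSemidecidable fun z : Z => ∀ t ∈ z.2.1, ∀ k ∈ t.2.2,
        IsNode z.2.1 z.2.2.1 (k :: t.1) := by
      refine .forall_mem hN (p := fun (z : Z) t => ∀ k ∈ t.2.2, IsNode z.2.1 z.2.2.1 (k :: t.1)) ?_
      refine .forall_mem (Computable.snd.comp (Computable.snd.comp .snd))
        (p := fun (x : Z × NodeCode n) k => IsNode x.1.2.1 x.1.2.2.1 (k :: x.2.1)) ?_
      have hz : Computable fun x : (Z × NodeCode n) × ℕ => x.1.1 := Computable.fst.comp .fst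
      exact hnode (hN.comp hz) (hL.comp hz) (Computable.list_cons.comp .snd
        (Computable.fst.comp (Computable.snd.comp .fst)))
    have h3 : IsSemidecidable fun z : Z => ∀ q ∈ z.2.2.1, ∀ f ∈ z.1,
        codedPoly ν f ∈ (codedIdeal ν q).map C := by
      refine .forall_mem hL (p := fun (z : Z) q => ∀ f ∈ z.1,
        codedPoly ν f ∈ (codedIdeal ν q).map C) ?_
      exact .forall_mem (hF.comp .fst) (p := fun (x : Z × List ℕ) f =>
        codedPoly ν f ∈ (codedIdeal ν x.2).map C)
        (isSemidecidable_mem_map_C hν hdet .snd (Computable.snd.comp .fst))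
    have h4 : IsSemidecidable fun z : Z => IsNode z.2.1 z.2.2.1 [] := hnode hN hL (.const [])
    have h5 : IsSemidecidable fun z : Z => ∀ q ∈ z.2.2.1, ∀ k ∈ z.2.2.2,
        ν k ∈ codedIdeal ν q := by
      refine .forall_mem hL (p := fun (z : Z) q => ∀ k ∈ z.2.2.2, ν k ∈ codedIdeal ν q) ?_
      exact .forall_mem (hI.comp .fst) (p := fun (x : Z × List ℕ) k => ν k ∈ codedIdeal ν x.2)
        (hdet.mem .snd (Computable.snd.comp .fst))
    have h6 : IsSemidecidable fun z : Z => ∀ f ∈ z.1,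
        codedPoly ν f ∈ (codedIdeal ν z.2.2.2).map C :=
      .forall_mem hF (p := fun (z : Z) f => codedPoly ν f ∈ (codedIdeal ν z.2.2.2).map C)
        (isSemidecidable_mem_map_C hν hdet .snd (hI.comp .fst))
    exact h1.and (h2.and (h3.and (h4.and (h5.and h6))))
  obtain ⟨A, hA, hAS⟩ := hS.exists_computable (R := S) (by
    intro F
    obtain ⟨N, L, hNL, hroot⟩ := exists_isTree hr hν.surjective F []
    obtain ⟨I, hFI, hI⟩ := exists_coeff_list hν.surjective F
    refine ⟨(N, L, I), hNL.generic, hNL.branch, hNL.leaf, hroot, fun q hq k hk => ?_, hFI⟩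
    obtain ⟨f, hf, γ, h⟩ := hI k hk
    rw [h]
    exact mem_map_C_iff.1 (hNL.leaf q hq f hf) γ)
  have htriple : Computable₂ fun (_ : List (PolyCode n)) (t : NodeCode n) =>
      (t.2.1.map Prod.fst, t.1, prod t.2.2) := by
    have ht : Computable₂ fun (_ : List (PolyCode n)) (t : NodeCode n) => t := .snd
    exact (Computable.list_map (Computable.fst.comp (Computable.snd.comp ht))
      (Computable.fst.comp .snd).to₂).pair ((Computable.fst.comp ht).pair
      (hprod.comp (Computable.snd.comp (Computable.snd.comp ht))))
  refine ⟨fun F => ((A F).1.map fun t => (t.2.1.map Prod.fst, t.1, prod t.2.2), (A F).2.2),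
    (Computable.list_map (Computable.fst.comp hA) htriple).pair
      (Computable.snd.comp (Computable.snd.comp hA)), fun F => ?_⟩
  obtain ⟨h1, h2, h3, h4, h5, h6⟩ := hAS F
  exact (IsTree.mk h1 h2 h3).isStratification hr h4 h5 h6 prod_spec

end Algorithms

theorem mainTheorem8 {C : Type u} [CommRing C] [IsDomain C]
    (ν : ℕ → C) (hν : IsEffectivePresentation ν) (hdet : IsDetachable ν)
    (n : ℕ) (r : (Fin n →₀ ℕ) → (Fin n →₀ ℕ) → Prop)
    (hr : IsMonomialOrder r) (hdec : IsDecidableOrder r) :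
    -- the basis and the elements `hᵢ` are computable from generators of `J` and `Q`
    (∃ A : List (PolyCode n) × List ℕ → List (PolyCode n) × List ℕ, Computable A ∧
      ∀ (F : List (PolyCode n)) (q : List ℕ),
        ¬ codedPolyIdeal ν F ≤ (codedIdeal ν q).map MvPolynomial.C →
        IsParametricBasis.{u, v} r (codedPolyIdeal ν F) (codedIdeal ν q)
          (codedPolySet ν (A (F, q)).1) ((A (F, q)).2.map ν)) ∧
    (IsNoetherianRing C →
      -- with computable intersections, the stratification is computable from generators of `J`
      (HasComputableIntersections ν →
        ∃ A : List (PolyCode n) → TriplesCode n × List ℕ, Computable A ∧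
          ∀ F : List (PolyCode n),
            IsStratification.{u, v} r (codedPolyIdeal ν F)
              (codedTriples ν (A F).1) (codedIdeal ν (A F).2)) ∧
      -- without them, it is computable for the `J` that no specialization annihilates
      (∃ A : List (PolyCode n) → TriplesCode n × List ℕ, Computable A ∧
          ∀ F : List (PolyCode n),
            (∀ (K : Type v) [Field K] (σ : C →+* K),
              ∃ f ∈ codedPolyIdeal ν F, MvPolynomial.map σ f ≠ 0) →
            IsStratification.{u, v} r (codedPolyIdeal ν F)
              (codedTriples ν (A F).1) (codedIdeal ν (A F).2))) := by
  refine ⟨exists_computable_parametricBasis hr hdec hν hdet, fun _ => ⟨fun _ => ?_, ?_⟩⟩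
  · exact exists_computable_stratification hr hdec hν hdet
  · obtain ⟨A, hA, h⟩ := exists_computable_stratification hr hdec hν hdet
    exact ⟨A, hA, fun F _ => h F⟩
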